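/- Let $S_{\mathbb Z}$ be the group of permutations of $\mathbb Z$ fixing all but finitely many integers, $\ell(u)$ the number of inversions of $u$, $s_m$ the transposition of $m$ and $m+1$, and $(\tau w)(i+1)=w(i)+1$. For $w\in S_n$ let $\mathfrak S_w=\partial_{i_1}\cdots\partial_{i_r}\bigl(x_1^{n-1}x_2^{n-2}\cdots x_{n-1}\bigr)$ be the Schubert polynomial, where $s_{i_1}\cdots s_{i_r}$ is a reduced decomposition of $w^{-1}w_0$, $w_0=(n,n-1,\dots,1)$ and $\partial_i f=(f-s_if)/(x_i-x_{i+1})$. For $w\in S_{\mathbb Z}$ let $$\overleftarrow{\mathfrak S}_w=\lim_{N\to\infty}\mathfrak S_{\tau^N w}(x_{1-N},x_{2-N},x_{3-N},\dots)$$ (coefficientwise limit) be the back stable Schubert polynomial, a formal power series in the variables $x_i$, $i\in\mathbb Z$, over $\mathbb Q$. Let $\xi$ be the operator for which the coefficient of $x^\gamma$ in $\xi(f)$ is $\lim_{m\to-\infty}$ of the coefficient of $x^\gamma x_m$ in $f$, defined for those $f$ for which all these limits exist (as eventually constant values). Let $\nabla$ be the linear operator on the $\mathbb Q$-span of the (linearly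 independent) series $\overleftarrow{\mathfrak S}_u$, $u\in S_{\mathbb Z}$, with $$\nabla\overleftarrow{\mathfrak S}_u=\sum_{m\in\mathbb Z:\ \ell(s_mu)=\ell(u)-1} m\,\overleftarrow{\mathfrak S}_{s_mu}.$$ **Theorem.** Let $\lambda$ be a Young diagram and $k\in\mathbb Z$, and let $s_\lambda(x_i,\,i\le k)$ be the Schur function of $\lambda$ in the variables $x_i$, $i\le k$. Then $s_\lambda(x_i,\,i\le k)$ lies in the domains of $\xi$ and of $\nabla$, and $$\xi\bigl(s_\lambda(x_i,\,i\le k)\bigr)=\sum_{\lambda'=\lambda-(i,j)} s_{\lambda'}(x_i,\,i\le k),\qquad \nabla\bigl(s_\lambda(x_i,\,i\le k)\bigr)=\sum_{\lambda'=\lambda-(i,j)} (j-i+k)\,s_{\lambda'}(x_i,\,i\le k),$$ where both sums run over the boxes $(i,j)$ (row $i$, column $j$) of $\lambda$ whose removal leaves a Young diagram $\lambda'$. -/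

import Mathlib

namespace BackStable

open Filter

noncomputable section

/-! ### Permutations of the integers -/

/-- `w` belongs to `S_ℤ`: it fixes all but finitely many integers. -/
def IsFinitary (w : Equiv.Perm ℤ) : Prop := {i : ℤ | w i ≠ i}.Finite

/-- The simple transposition `s_i`, exchanging `i` and `i + 1`. -/
def simpleTransposition (i : ℤ) : Equiv.Perm ℤ := Equiv.swap i (i + 1)

/-- The length of a permutation: its number of inversions. -/
def length (w : Equiv.Perm ℤ) : ℕ :=
  {p : ℤ × ℤ | p.1 < p.2 ∧ w p.2 < w p.1}.ncard

/-- `l = [i₁, …, i_r]` is a reduced decomposition of `w`: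
`s_{i₁} ⋯ s_{i_r} = w` and `r` is the length of `w`. -/
def IsReducedDecomposition (l : List ℤ) (w : Equiv.Perm ℤ) : Prop :=
  (l.map simpleTransposition).prod = w ∧ l.length = length w

/-- `w` belongs to `S_n`, the permutations of `{1, …, n}` (extended by the identity). -/
def IsPermOfSize (n : ℕ) (w : Equiv.Perm ℤ) : Prop :=
  ∀ i : ℤ, ¬ (1 ≤ i ∧ i ≤ n) → w i = i

/-- The longest element `(n, n - 1, …, 1)` of `S_n`. -/
def longestPerm (n : ℕ) : Equiv.Perm ℤ :=
  Function.Involutive.toPerm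
    (fun i : ℤ => if 1 ≤ i ∧ i ≤ n then (n : ℤ) + 1 - i else i)
    (by intro i; dsimp only; split_ifs <;> omega)

/-- The `N`-fold shift of `w`: `(shift N w) (i + N) = w i + N`. -/
def shift (N : ℕ) (w : Equiv.Perm ℤ) : Equiv.Perm ℤ :=
  Equiv.addRight (N : ℤ) * w * (Equiv.addRight (N : ℤ))⁻¹

/-! ### Divided differences and Schubert polynomials -/

/-- `s_i f`: the polynomial `f` with `x_i` and `x_{i+1}` exchanged. -/
def swapVars (i : ℤ) (f : MvPolynomial ℤ ℚ) : MvPolynomial ℤ ℚ :=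
  MvPolynomial.rename (simpleTransposition i) f

theorem sub_dvd_sub_swapVars (i : ℤ) (f : MvPolynomial ℤ ℚ) :
    (MvPolynomial.X i - MvPolynomial.X (i + 1)) ∣ f - swapVars i f := by
  induction f using MvPolynomial.induction_on with
  | C a => simp [swapVars]
  | add p q hp hq =>
    have h : p + q - swapVars i (p + q) = (p - swapVars i p) + (q - swapVars i q) := by
      simp only [swapVars, map_add]; ring
    rw [h]; exact dvd_add hp hq
  | mul_X p n hp =>
    have hn : (MvPolynomial.X i - MvPolynomial.X (i + 1) : MvPolynomial ℤ ℚ) ∣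
        MvPolynomial.X n - MvPolynomial.X (simpleTransposition i n) := by
      unfold simpleTransposition
      rcases eq_or_ne n i with rfl | h1
      · simp
      · rcases eq_or_ne n (i + 1) with rfl | h2
        · exact ⟨-1, by rw [Equiv.swap_apply_right]; ring⟩
        · rw [Equiv.swap_apply_of_ne_of_ne h1 h2]; simp
    have h : p * MvPolynomial.X n - swapVars i (p * MvPolynomial.X n)
        = (p - swapVars i p) * MvPolynomial.X n + swapVars i p *
          (MvPolynomial.X n - MvPolynomial.X (simpleTransposition i n)) := by
      simp only [swapVars, map_mul, MvPolynomial.rename_X]; ring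
    rw [h]; exact dvd_add (hp.mul_right _) (hn.mul_left _)

/-- The divided difference `∂_i f = (f - s_i f) / (x_i - x_{i+1})`, i.e. the (unique) polynomial
with `f - s_i f = (x_i - x_{i+1}) * ∂_i f`. -/
def dividedDifference (i : ℤ) (f : MvPolynomial ℤ ℚ) : MvPolynomial ℤ ℚ :=
  (sub_dvd_sub_swapVars i f).choose

theorem dividedDifference_spec (i : ℤ) (f : MvPolynomial ℤ ℚ) :
    f - swapVars i f
      = (MvPolynomial.X i - MvPolynomial.X (i + 1)) * dividedDifference i f :=
  (sub_dvd_sub_swapVars i f).choose_spec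

/-- The monomial `x_1^{n-1} x_2^{n-2} ⋯ x_{n-1}`, the Schubert polynomial of `longestPerm n`. -/
def staircaseMonomial (n : ℕ) : MvPolynomial ℤ ℚ :=
  ∏ i ∈ Finset.range n, MvPolynomial.X ((i : ℤ) + 1) ^ (n - 1 - i)

open Classical in
/-- The Schubert polynomial of a finitary permutation `w` of `{1, 2, …}`: if `w` lies in `S_n` and
`[i₁, …, i_r]` is a reduced decomposition of `w⁻¹ w₀`, where `w₀` is the longest element of `S_n`,
then it is `∂_{i₁} ⋯ ∂_{i_r} (x_1^{n-1} x_2^{n-2} ⋯ x_{n-1})`. The result does not depend on the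
choice of `n` and of the reduced decomposition. (The value is `0` if `w` lies in no `S_n`.) -/
def schubert (w : Equiv.Perm ℤ) : MvPolynomial ℤ ℚ :=
  if h : ∃ p : ℕ × List ℤ,
      IsPermOfSize p.1 w ∧ IsReducedDecomposition p.2 (w⁻¹ * longestPerm p.1) then
    h.choose.2.foldr dividedDifference (staircaseMonomial h.choose.1)
  else 0

/-! ### Back stable Schubert polynomials

Elements of `Λ ⊗ ℚ[x_i, i ∈ ℤ]` are regarded as formal power series in the variables `x_i`,
`i ∈ ℤ`; limits are taken coefficientwise, for the discrete topology on the coefficients. -/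

open Classical in
/-- The value at which the family `a` stabilizes along the filter `l` (`0` if it does not). -/
def stableValue {ι : Type} (l : Filter ι) (a : ι → ℚ) : ℚ :=
  if h : ∃ c : ℚ, ∀ᶠ i in l, a i = c then h.choose else 0

theorem stableValue_eq {ι : Type} {l : Filter ι} [l.NeBot] {a : ι → ℚ} {c : ℚ}
    (hc : ∀ᶠ i in l, a i = c) : stableValue l a = c := by
  have h : ∃ c : ℚ, ∀ᶠ i in l, a i = c := ⟨c, hc⟩
  rw [stableValue, dif_pos h]
  obtain ⟨i, h1, h2⟩ := (h.choose_spec.and hc).exists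
  exact h1.symm.trans h2

/-- The back stable Schubert polynomial of `w ∈ S_ℤ`: the coefficientwise limit, as `N → ∞`, of
`𝔖_{τ^N w}(x_{1-N}, x_{2-N}, …)`, i.e. of the Schubert polynomial of the `N`-fold shift of `w` in
which every `x_i` is replaced by `x_{i-N}`. -/
def backStableSchubert (w : Equiv.Perm ℤ) : MvPowerSeries ℤ ℚ :=
  fun γ => stableValue atTop fun N : ℕ =>
    MvPolynomial.coeff γ
      (MvPolynomial.rename (fun i : ℤ => i - (N : ℤ)) (schubert (shift N w)))

/-! ### The operators `ξ` and `∇` -/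

/-- The operator `ξ`: the coefficient of `x^γ` in `ξ f` is the limit, as `k → -∞`, of the
coefficient of `x^γ x_k` in `f`. It is defined on the space of all `f` for which these limits
exist. -/
def xi : MvPowerSeries ℤ ℚ →ₗ.[ℚ] MvPowerSeries ℤ ℚ where
  domain :=
    { carrier := {f | ∀ γ : ℤ →₀ ℕ, ∃ c : ℚ, ∀ᶠ k : ℤ in atBot,
        MvPowerSeries.coeff (γ + Finsupp.single k 1) f = c}
      add_mem' := by
        intro f g hf hg γ
        obtain ⟨c, hc⟩ := hf γ
        obtain ⟨d, hd⟩ := hg γ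
        exact ⟨c + d, by filter_upwards [hc, hd] with k h1 h2; rw [map_add, h1, h2]⟩
      zero_mem' := fun γ => ⟨0, by simp⟩
      smul_mem' := by
        intro r f hf γ
        obtain ⟨c, hc⟩ := hf γ
        exact ⟨r * c, by filter_upwards [hc] with k h1; rw [map_smul, h1, smul_eq_mul]⟩ }
  toFun :=
    { toFun := fun f γ => stableValue atBot fun k : ℤ =>
        MvPowerSeries.coeff (γ + Finsupp.single k 1) f.1
      map_add' := by
        intro f g
        funext γ
        obtain ⟨c, hc⟩ := f.2 γ
        obtain ⟨d, hd⟩ := g.2 γ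
        refine (stableValue_eq (c := c + d) ?_).trans
          (congrArg₂ (· + ·) (stableValue_eq hc).symm (stableValue_eq hd).symm)
        filter_upwards [hc, hd] with k h1 h2
        rw [Submodule.coe_add, map_add, h1, h2]
      map_smul' := by
        intro r f
        funext γ
        obtain ⟨c, hc⟩ := f.2 γ
        refine (stableValue_eq (c := r * c) ?_).trans
          (congrArg (r * ·) (stableValue_eq hc).symm)
        filter_upwards [hc] with k h1
        rw [Submodule.coe_smul, map_smul, h1, smul_eq_mul] }

/-- The prescribed value of `∇` on the back stable Schubert polynomial of `u`:
the sum of `k` times the back stable Schubert polynomial of `s_k u`, over all integers `k` with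
`ℓ(s_k u) = ℓ(u) - 1`. -/
def nablaValue (u : Equiv.Perm ℤ) : MvPowerSeries ℤ ℚ :=
  ∑ᶠ (k : ℤ) (_ : length (simpleTransposition k * u) + 1 = length u),
    (k : ℚ) • backStableSchubert (simpleTransposition k * u)

/-- The operator `∇`: the linear operator, defined on the linear span of the back stable Schubert
polynomials of all `u ∈ S_ℤ`, which sends the back stable Schubert polynomial of `u` to
`nablaValue u`. It is given through its graph, the span of these argument-value pairs (which is
single-valued because the back stable Schubert polynomials are linearly independent). -/
def nabla : MvPowerSeries ℤ ℚ →ₗ.[ℚ] MvPowerSeries ℤ ℚ :=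
  (Submodule.span ℚ {p : MvPowerSeries ℤ ℚ × MvPowerSeries ℤ ℚ |
    ∃ u : Equiv.Perm ℤ, IsFinitary u ∧ p = (backStableSchubert u, nablaValue u)}).toLinearPMap

/-! ### Young diagrams and Schur functions -/

/-- The Schur function `s_lam(x_i, i ∈ (-∞, k])`, the generating function of semistandard Young
tableaux of shape `lam`, an entry `n ∈ {0, 1, 2, …}` contributing the variable `x_{k-n}`: the
coefficient of `x^γ` is the number of tableaux with content `γ`. -/
def schur (lam : YoungDiagram) (k : ℤ) : MvPowerSeries ℤ ℚ :=
  fun γ => (Nat.card {T : SemistandardYoungTableau lam //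
    ∑ c ∈ lam.cells, Finsupp.single (k - (T c.1 c.2 : ℤ)) 1 = γ} : ℚ)

open Classical in
/-- The boxes of `lam` whose deletion leaves a Young diagram. -/
def removableBoxes (lam : YoungDiagram) : Finset (ℕ × ℕ) :=
  lam.cells.filter fun c => IsLowerSet ((lam.cells.erase c : Finset (ℕ × ℕ)) : Set (ℕ × ℕ))

/-- The Young diagram obtained from `lam` by deleting the removable box `c`. -/
def removeBox (lam : YoungDiagram) (c : {c : ℕ × ℕ // c ∈ removableBoxes lam}) : YoungDiagram where
  cells := lam.cells.erase c.1
  isLowerSet := by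
    classical
    have h := (Finset.mem_filter.1 c.2).2
    convert h

/-- The content of the box in row `c.1` and column `c.2`: column index minus row index. -/
def content (c : ℕ × ℕ) : ℤ := (c.2 : ℤ) - (c.1 : ℤ)

end

end BackStable

/-!
The statement about `ξ` is a bijection of tableaux: if `x_m` precedes all variables of `x^γ`, a
tableau of weight `x^γ x_m` has a unique box with the largest entry, this box is removable, and
removing it leaves an arbitrary tableau of weight `x^γ` (`ncard_weight_add_single`).

The statement about `∇` holds because `s_λ(x_i, i ≤ k)` is the back stable Schubert polynomial of
the Grassmannian permutation of shape `λ` with descent at `k` (`schur_eq_backStableSchubert`). The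
left descents `m` of this permutation are the numbers `k + j - i` for the removable boxes
`(i, j)`, and multiplication by `s_m` on the left removes the box (`grassmannian_descent_iff`,
`simpleTransposition_mul_grassmannian`), so the definition of `∇` gives the right-hand side. This
uses that `∇` is well defined, that is, the linear independence of back stable Schubert
polynomials.

All facts about Schubert polynomials come from the Fomin-Stanley factorization. Let `u_j` be the
nilCoxeter generators, acting on families of polynomials indexed by permutations (`leftNil`), and
let `A_j(x) = (1 + x u_b) ⋯ (1 + x u_{j+1}) (1 + x u_j)` (`fan`). The coefficients of
`A_a(x_a) A_{a+1}(x_{a+1}) ⋯ A_b(x_b)` form the family `schubertFamily`. As `A_j(x)` and `A_j(y)` commute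
(`fan_commute`), `∂_i` acts on this family by multiplication of the index by `s_i` on the right
(`dividedDifference_schubertFamily`). Its value at the longest permutation is the staircase
monomial, so its members are the Schubert polynomials, for every choice of the reduced
decomposition (`schubert_eq`). Moreover,

* setting the first variable to zero removes the first factor, so the coefficients stabilize
  (`coeff_backStableSchubert`);
* constant terms of iterated divided differences are dual functionals, which proves linear
  independence (`exists_dual_schubertFamily`, `linearIndepOn_backStableSchubert`);
* at Grassmannian permutations, the factor `1 + x u_j` either keeps a box of content `j - k` or
  removes it and records an entry of the tableau, so one fan after the other builds up the
  generating function of semistandard tableaux (`coeff_fan_grassmannian`,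
  `coeff_schubertFamily_grassmannian`).
-/

namespace BackStable

open Filter

noncomputable section

/-! ### Finitary permutations of the integers and their length -/

/-- `w` fixes every integer outside the interval `[p, q]`. -/
def FixesOutside (p q : ℤ) (w : Equiv.Perm ℤ) : Prop := ∀ x : ℤ, ¬ (p ≤ x ∧ x ≤ q) → w x = x

theorem simpleTransposition_left (i : ℤ) : simpleTransposition i i = i + 1 :=
  Equiv.swap_apply_left _ _

theorem simpleTransposition_right (i : ℤ) : simpleTransposition i (i + 1) = i :=
  Equiv.swap_apply_right _ _

theorem simpleTransposition_of_ne {i x : ℤ} (h : x ≠ i) (h' : x ≠ i + 1) :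
    simpleTransposition i x = x :=
  Equiv.swap_apply_of_ne_of_ne h h'

theorem simpleTransposition_apply (i x : ℤ) :
    simpleTransposition i x = if x = i then i + 1 else if x = i + 1 then i else x :=
  Equiv.swap_apply_def _ _ _

@[simp] theorem simpleTransposition_inv (i : ℤ) :
    (simpleTransposition i)⁻¹ = simpleTransposition i :=
  Equiv.swap_inv _ _

@[simp] theorem simpleTransposition_mul_self (i : ℤ) :
    simpleTransposition i * simpleTransposition i = 1 :=
  Equiv.swap_mul_self _ _

@[simp] theorem simpleTransposition_apply_self (i x : ℤ) :
    simpleTransposition i (simpleTransposition i x) = x :=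
  Equiv.swap_apply_self _ _ _

@[simp] theorem simpleTransposition_mul_cancel (i : ℤ) (w : Equiv.Perm ℤ) :
    simpleTransposition i * (simpleTransposition i * w) = w := by
  rw [← mul_assoc, simpleTransposition_mul_self, one_mul]

@[simp] theorem mul_simpleTransposition_cancel (i : ℤ) (w : Equiv.Perm ℤ) :
    w * simpleTransposition i * simpleTransposition i = w := by
  rw [mul_assoc, simpleTransposition_mul_self, mul_one]

theorem FixesOutside.mono {p q p' q' : ℤ} {w : Equiv.Perm ℤ} (h : FixesOutside p q w)
    (hp : p' ≤ p) (hq : q ≤ q') : FixesOutside p' q' w :=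
  fun x hx => h x (by omega)

theorem FixesOutside.inv {p q : ℤ} {w : Equiv.Perm ℤ} (h : FixesOutside p q w) :
    FixesOutside p q w⁻¹ := fun x hx => by
  rw [Equiv.Perm.inv_eq_iff_eq, h x hx]

theorem FixesOutside.mul {p q : ℤ} {w v : Equiv.Perm ℤ} (h : FixesOutside p q w)
    (h' : FixesOutside p q v) : FixesOutside p q (w * v) := fun x hx => by
  rw [Equiv.Perm.mul_apply, h' x hx, h x hx]

theorem FixesOutside.simpleTransposition {p q i : ℤ} (hp : p ≤ i) (hq : i + 1 ≤ q) :
    FixesOutside p q (simpleTransposition i) := fun x hx =>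
  simpleTransposition_of_ne (by omega) (by omega)

theorem FixesOutside.mem {p q : ℤ} {w : Equiv.Perm ℤ} (h : FixesOutside p q w) {x : ℤ}
    (hx : p ≤ x ∧ x ≤ q) : p ≤ w x ∧ w x ≤ q := by
  by_contra hc
  have h1 : w x = x := w.injective (h _ hc)
  exact hc (by rwa [h1])

theorem FixesOutside.isFinitary {p q : ℤ} {w : Equiv.Perm ℤ} (h : FixesOutside p q w) :
    IsFinitary w :=
  (Set.finite_Icc p q).subset fun x hx => by
    by_contra hc
    exact hx (h x hc)

theorem IsFinitary.exists_fixesOutside {w : Equiv.Perm ℤ} (h : IsFinitary w) :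
    ∃ p q : ℤ, FixesOutside p q w := by
  obtain ⟨p, hp⟩ := h.bddBelow
  obtain ⟨q, hq⟩ := h.bddAbove
  refine ⟨p, q, fun x hx => ?_⟩
  by_contra hc
  exact hx ⟨hp hc, hq hc⟩

theorem IsFinitary.mul {w v : Equiv.Perm ℤ} (h : IsFinitary w) (h' : IsFinitary v) :
    IsFinitary (w * v) := by
  obtain ⟨p, q, hw⟩ := h.exists_fixesOutside
  obtain ⟨p', q', hv⟩ := h'.exists_fixesOutside
  exact ((hw.mono (min_le_left p p') (le_max_left q q')).mul
    (hv.mono (min_le_right p p') (le_max_right q q'))).isFinitary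

theorem isFinitary_simpleTransposition (i : ℤ) : IsFinitary (simpleTransposition i) :=
  (FixesOutside.simpleTransposition le_rfl le_rfl).isFinitary

theorem IsFinitary.inv {w : Equiv.Perm ℤ} (h : IsFinitary w) : IsFinitary w⁻¹ := by
  obtain ⟨p, q, hw⟩ := h.exists_fixesOutside
  exact hw.inv.isFinitary

theorem IsFinitary.finite_inversions {w : Equiv.Perm ℤ} (h : IsFinitary w) :
    {p : ℤ × ℤ | p.1 < p.2 ∧ w p.2 < w p.1}.Finite := by
  obtain ⟨p, q, hw⟩ := h.exists_fixesOutside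
  refine ((Set.finite_Icc p q).prod (Set.finite_Icc p q)).subset ?_
  rintro ⟨x, y⟩ ⟨hxy, hw'⟩
  simp only [Set.mem_prod, Set.mem_Icc] at hxy hw' ⊢
  by_cases hx : p ≤ x ∧ x ≤ q <;> by_cases hy : p ≤ y ∧ y ≤ q
  · exact ⟨hx, hy⟩
  · have := hw y hy; have := hw.mem hx; omega
  · have := hw x hx; have := hw.mem hy; omega
  · have := hw x hx; have := hw y hy; omega

theorem length_mul_simpleTransposition {w : Equiv.Perm ℤ} (hw : IsFinitary w) {i : ℤ}
    (h : w i < w (i + 1)) : length (w * simpleTransposition i) = length w + 1 := by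
  let e : ℤ × ℤ ≃ ℤ × ℤ := (simpleTransposition i).prodCongr (simpleTransposition i)
  have key : {p : ℤ × ℤ | p.1 < p.2 ∧
        (w * simpleTransposition i) p.2 < (w * simpleTransposition i) p.1}
      = insert (i, i + 1) (e '' {p : ℤ × ℤ | p.1 < p.2 ∧ w p.2 < w p.1}) := by
    ext ⟨x, y⟩
    have he : (x, y) ∈ e '' {p : ℤ × ℤ | p.1 < p.2 ∧ w p.2 < w p.1} ↔
        simpleTransposition i x < simpleTransposition i y ∧
          w (simpleTransposition i y) < w (simpleTransposition i x) := by
      constructor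
      · rintro ⟨⟨a, b⟩, hab, heq⟩
        simp only [e, Equiv.prodCongr_apply, Prod.map_apply, Prod.mk.injEq] at heq
        obtain ⟨rfl, rfl⟩ := heq
        simpa using hab
      · intro hab
        exact ⟨(simpleTransposition i x, simpleTransposition i y), hab, by simp [e]⟩
    rw [Set.mem_insert_iff, he]
    simp only [Set.mem_ofPred_eq, Equiv.Perm.mul_apply, Prod.mk.injEq]
    by_cases h1 : x = i ∧ y = i + 1
    · obtain ⟨rfl, rfl⟩ := h1
      simp [simpleTransposition_left, simpleTransposition_right, h]
    · by_cases h2 : x = i + 1 ∧ y = i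
      · obtain ⟨rfl, rfl⟩ := h2
        simp only [simpleTransposition_left, simpleTransposition_right]
        omega
      · have hlt : simpleTransposition i x < simpleTransposition i y ↔ x < y := by
          simp only [simpleTransposition_apply]
          split_ifs <;> omega
        rw [hlt]
        tauto
  have hnot : (i, i + 1) ∉ e '' {p : ℤ × ℤ | p.1 < p.2 ∧ w p.2 < w p.1} := by
    rintro ⟨⟨a, b⟩, hab, heq⟩
    simp only [e, Equiv.prodCongr_apply, Prod.map_apply, Prod.mk.injEq] at heq
    have ha : a = simpleTransposition i i := by rw [← simpleTransposition_apply_self i a, heq.1]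
    have hb : b = simpleTransposition i (i + 1) := by
      rw [← simpleTransposition_apply_self i b, heq.2]
    rw [simpleTransposition_left] at ha
    rw [simpleTransposition_right] at hb
    have := hab.1
    simp only at this
    omega
  rw [length, key, Set.ncard_insert_of_notMem hnot (hw.finite_inversions.image _),
    Set.ncard_image_of_injective _ e.injective, length]

theorem length_inv (w : Equiv.Perm ℤ) : length w⁻¹ = length w := by
  refine Set.ncard_congr (fun p _ => (w⁻¹ p.2, w⁻¹ p.1)) ?_ ?_ ?_
  · rintro ⟨x, y⟩ ⟨h1, h2⟩
    exact ⟨h2, by simpa using h1⟩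
  · rintro ⟨x, y⟩ ⟨x', y'⟩ _ _ h
    simp only [Prod.mk.injEq, EmbeddingLike.apply_eq_iff_eq] at h
    exact Prod.ext h.2 h.1
  · rintro ⟨x, y⟩ ⟨h1, h2⟩
    exact ⟨(w y, w x), ⟨h2, by simpa using h1⟩, by simp⟩

theorem length_mul_simpleTransposition_of_descent {w : Equiv.Perm ℤ} (hw : IsFinitary w) {i : ℤ}
    (h : w (i + 1) < w i) : length (w * simpleTransposition i) + 1 = length w := by
  have := length_mul_simpleTransposition (hw.mul (isFinitary_simpleTransposition i)) (i := i)
    (by simpa [simpleTransposition_left, simpleTransposition_right] using h)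
  rw [mul_simpleTransposition_cancel] at this
  exact this.symm

theorem length_simpleTransposition_mul_inv (w : Equiv.Perm ℤ) (i : ℤ) :
    length (simpleTransposition i * w) = length (w⁻¹ * simpleTransposition i) := by
  rw [← length_inv, mul_inv_rev, simpleTransposition_inv]

theorem length_simpleTransposition_mul_add_one_iff {w : Equiv.Perm ℤ} (hw : IsFinitary w) {i : ℤ} :
    length (simpleTransposition i * w) + 1 = length w ↔ w⁻¹ (i + 1) < w⁻¹ i := by
  rw [length_simpleTransposition_mul_inv, ← length_inv w]
  refine ⟨fun h => ?_, length_mul_simpleTransposition_of_descent hw.inv⟩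
  by_contra hc
  have hne : w⁻¹ i ≠ w⁻¹ (i + 1) := fun h => by simp at h
  have := length_mul_simpleTransposition hw.inv (i := i) (by omega)
  omega

theorem length_simpleTransposition_mul_eq_add_one_iff {w : Equiv.Perm ℤ} (hw : IsFinitary w)
    {i : ℤ} : length (simpleTransposition i * w) = length w + 1 ↔ w⁻¹ i < w⁻¹ (i + 1) := by
  rw [length_simpleTransposition_mul_inv, ← length_inv w]
  refine ⟨fun h => ?_, length_mul_simpleTransposition hw.inv⟩
  by_contra hc
  have hne : w⁻¹ i ≠ w⁻¹ (i + 1) := fun h => by simp at h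
  have := length_mul_simpleTransposition_of_descent hw.inv (i := i) (by omega)
  omega

theorem length_simpleTransposition_mul_le {w : Equiv.Perm ℤ} (hw : IsFinitary w) (i : ℤ) :
    length (simpleTransposition i * w) ≤ length w + 1 := by
  have hne : w⁻¹ i ≠ w⁻¹ (i + 1) := fun h => by simp at h
  rcases lt_or_gt_of_ne hne with h | h
  · exact ((length_simpleTransposition_mul_eq_add_one_iff hw).2 h).le
  · have := (length_simpleTransposition_mul_add_one_iff hw).2 h
    omega

/-- A permutation of an interval without descents is the identity, because it is increasing. -/
theorem FixesOutside.exists_descent {p q : ℤ} {w : Equiv.Perm ℤ} (h : FixesOutside p q w)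
    (hw : w ≠ 1) : ∃ i, p ≤ i ∧ i + 1 ≤ q ∧ w (i + 1) < w i := by
  by_contra! hc
  have hmono : StrictMono w := by
    refine strictMono_int_of_lt_succ fun i => ?_
    have hne : w i ≠ w (i + 1) := fun h => by simp at h
    by_cases hp : p ≤ i
    · by_cases hq : i + 1 ≤ q
      · exact lt_of_le_of_ne (hc i hp hq) hne
      · have h1 := h (i + 1) (by omega)
        by_cases hi : i ≤ q
        · have := h.mem ⟨hp, hi⟩; omega
        · have := h i (by omega); omega
    · have h1 := h i (by omega)
      by_cases hi : p ≤ i + 1 ∧ i + 1 ≤ q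
      · have := h.mem hi; omega
      · have := h (i + 1) hi; omega
  apply hw
  ext x
  have hup : ∀ n : ℕ, p - 1 + n ≤ w (p - 1 + n) := by
    intro n
    induction n with
    | zero => rw [h _ (by simp)]
    | succ n ih =>
      have := hmono (show p - 1 + (n : ℤ) < p - 1 + ((n + 1 : ℕ) : ℤ) by push_cast; omega)
      push_cast at this ⊢
      omega
  have hdown : ∀ n : ℕ, w (q + 1 - n) ≤ q + 1 - n := by
    intro n
    induction n with
    | zero => rw [h _ (by simp)]
    | succ n ih =>
      have := hmono (show q + 1 - ((n + 1 : ℕ) : ℤ) < q + 1 - (n : ℤ) by push_cast; omega)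
      push_cast at this ⊢
      omega
  by_cases hx : p ≤ x ∧ x ≤ q
  · have h1 := hup (x - p + 1).toNat
    have h2 := hdown (q + 1 - x).toNat
    have e1 : p - 1 + ((x - p + 1).toNat : ℤ) = x := by omega
    have e2 : q + 1 - ((q + 1 - x).toNat : ℤ) = x := by omega
    rw [e1] at h1
    rw [e2] at h2
    exact le_antisymm h2 h1
  · exact h x hx

theorem length_one : length 1 = 0 := by
  rw [length]
  convert Set.ncard_empty (ℤ × ℤ)
  ext ⟨x, y⟩
  simp only [Set.mem_ofPred_eq, Equiv.Perm.coe_one, id_eq, Set.mem_empty_iff_false, iff_false]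
  omega

theorem IsFinitary.exists_isReducedDecomposition {w : Equiv.Perm ℤ} (hw : IsFinitary w) :
    ∃ l : List ℤ, IsReducedDecomposition l w := by
  induction h : length w using Nat.strong_induction_on generalizing w with
  | _ n ih =>
    by_cases h1 : w = 1
    · subst h1
      exact ⟨[], by simp [IsReducedDecomposition, length_one]⟩
    · obtain ⟨p, q, hpq⟩ := hw.inv.exists_fixesOutside
      obtain ⟨i, -, -, hi⟩ := hpq.exists_descent (by simpa using h1)
      have hlen := (length_simpleTransposition_mul_add_one_iff hw).2 hi
      obtain ⟨l, hl1, hl2⟩ := ih _ (by omega) ((isFinitary_simpleTransposition i).mul hw) rfl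
      refine ⟨i :: l, ?_, ?_⟩
      · rw [List.map_cons, List.prod_cons, hl1, simpleTransposition_mul_cancel]
      · rw [List.length_cons, hl2, hlen]

theorem isFinitary_prod (l : List ℤ) : IsFinitary (l.map simpleTransposition).prod := by
  induction l with
  | nil => simp [IsFinitary]
  | cons i l ih => exact (isFinitary_simpleTransposition i).mul ih

theorem length_prod_le (l : List ℤ) : length (l.map simpleTransposition).prod ≤ l.length := by
  induction l with
  | nil => simp [length_one]
  | cons i l ih =>
    rw [List.map_cons, List.prod_cons, List.length_cons]
    have := length_simpleTransposition_mul_le (isFinitary_prod l) i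
    omega

theorem IsReducedDecomposition.tail {i : ℤ} {l : List ℤ} {w : Equiv.Perm ℤ}
    (h : IsReducedDecomposition (i :: l) w) :
    IsReducedDecomposition l (simpleTransposition i * w) ∧ w⁻¹ (i + 1) < w⁻¹ i := by
  obtain ⟨h1, h2⟩ := h
  have hw : IsFinitary w := h1 ▸ isFinitary_prod (i :: l)
  rw [List.map_cons, List.prod_cons] at h1
  have h3 : (l.map simpleTransposition).prod = simpleTransposition i * w := by
    rw [← h1, simpleTransposition_mul_cancel]
  have h4 := length_prod_le l
  have h5 := length_simpleTransposition_mul_le ((isFinitary_simpleTransposition i).mul hw) i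
  rw [simpleTransposition_mul_cancel] at h5
  rw [List.length_cons] at h2
  rw [h3] at h4
  have h6 : length (simpleTransposition i * w) + 1 = length w := by omega
  exact ⟨⟨h3, by omega⟩, (length_simpleTransposition_mul_add_one_iff hw).1 h6⟩

/-! ### Divided differences -/

theorem X_sub_X_ne_zero (i : ℤ) :
    (MvPolynomial.X i - MvPolynomial.X (i + 1) : MvPolynomial ℤ ℚ) ≠ 0 := by
  rw [sub_ne_zero]
  intro h
  have := MvPolynomial.X_injective h
  omega

theorem dividedDifference_eq_of_eq {i : ℤ} {f g : MvPolynomial ℤ ℚ}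
    (h : f - swapVars i f = (MvPolynomial.X i - MvPolynomial.X (i + 1)) * g) :
    dividedDifference i f = g :=
  mul_left_cancel₀ (X_sub_X_ne_zero i) ((dividedDifference_spec i f).symm.trans h)

/-- The divided difference as a linear map. -/
def dividedDifferenceLinear (i : ℤ) : MvPolynomial ℤ ℚ →ₗ[ℚ] MvPolynomial ℤ ℚ where
  toFun := dividedDifference i
  map_add' f g := by
    apply dividedDifference_eq_of_eq
    rw [mul_add, ← dividedDifference_spec, ← dividedDifference_spec]
    simp only [swapVars, map_add]
    ring
  map_smul' c f := by
    apply dividedDifference_eq_of_eq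
    rw [RingHom.id_apply, mul_smul_comm, ← dividedDifference_spec, smul_sub]
    simp only [swapVars, map_smul]

theorem swapVars_X (i j : ℤ) :
    swapVars i (MvPolynomial.X j) = MvPolynomial.X (simpleTransposition i j) :=
  MvPolynomial.rename_X _ _

/-! ### The nilCoxeter operators -/

/-- Families of polynomials indexed by the permutations of `ℤ`. -/
abbrev PermFun : Type := Equiv.Perm ℤ → MvPolynomial ℤ ℚ

/-- The nilCoxeter generator acting on the left: the value at `w` of the new family is the value
of the old one at `s_j w` if `s_j w` is shorter than `w`, and `0` otherwise. -/
def leftNil (j : ℤ) : Module.End (MvPolynomial ℤ ℚ) PermFun where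
  toFun g w := if w⁻¹ (j + 1) < w⁻¹ j then g (simpleTransposition j * w) else 0
  map_add' g h := by funext w; simp only [Pi.add_apply]; split_ifs <;> simp
  map_smul' c g := by
    funext w; simp only [Pi.smul_apply, RingHom.id_apply]; split_ifs <;> simp

/-- The nilCoxeter generator acting on the right: the value at `w` of the new family is the value
of the old one at `w s_i` if `w s_i` is shorter than `w`, and `0` otherwise. -/
def rightNil (i : ℤ) : Module.End (MvPolynomial ℤ ℚ) PermFun where
  toFun g w := if w (i + 1) < w i then g (w * simpleTransposition i) else 0
  map_add' g h := by funext w; simp only [Pi.add_apply]; split_ifs <;> simp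
  map_smul' c g := by
    funext w; simp only [Pi.smul_apply, RingHom.id_apply]; split_ifs <;> simp

theorem leftNil_apply (j : ℤ) (g : PermFun) (w : Equiv.Perm ℤ) :
    leftNil j g w = if w⁻¹ (j + 1) < w⁻¹ j then g (simpleTransposition j * w) else 0 := rfl

theorem rightNil_apply (i : ℤ) (g : PermFun) (w : Equiv.Perm ℤ) :
    rightNil i g w = if w (i + 1) < w i then g (w * simpleTransposition i) else 0 := rfl

theorem simpleTransposition_mul_inv_apply (j : ℤ) (w : Equiv.Perm ℤ) (x : ℤ) :
    (simpleTransposition j * w)⁻¹ x = w⁻¹ (simpleTransposition j x) := by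
  rw [mul_inv_rev, simpleTransposition_inv, Equiv.Perm.mul_apply]

theorem leftNil_mul_self (j : ℤ) : leftNil j * leftNil j = 0 := by
  apply LinearMap.ext
  intro g
  funext w
  simp only [Module.End.mul_apply, leftNil_apply, simpleTransposition_mul_inv_apply,
    simpleTransposition_left, simpleTransposition_right, LinearMap.zero_apply, Pi.zero_apply]
  split_ifs
  · omega
  all_goals rfl

theorem simpleTransposition_comm {i j : ℤ} (h : i + 1 < j) :
    simpleTransposition i * simpleTransposition j
      = simpleTransposition j * simpleTransposition i := by
  ext x
  simp only [Equiv.Perm.mul_apply, simpleTransposition_apply]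
  split_ifs <;> omega

theorem simpleTransposition_braid (i : ℤ) :
    simpleTransposition i * simpleTransposition (i + 1) * simpleTransposition i
      = simpleTransposition (i + 1) * simpleTransposition i * simpleTransposition (i + 1) := by
  ext x
  simp only [Equiv.Perm.mul_apply, simpleTransposition_apply]
  split_ifs <;> omega

theorem leftNil_comm {i j : ℤ} (h : i + 1 < j) :
    leftNil i * leftNil j = leftNil j * leftNil i := by
  apply LinearMap.ext
  intro g
  funext w
  simp only [Module.End.mul_apply, leftNil_apply, simpleTransposition_mul_inv_apply]
  rw [simpleTransposition_of_ne (i := i) (x := j + 1) (by omega) (by omega),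
    simpleTransposition_of_ne (i := i) (x := j) (by omega) (by omega),
    simpleTransposition_of_ne (i := j) (x := i + 1) (by omega) (by omega),
    simpleTransposition_of_ne (i := j) (x := i) (by omega) (by omega),
    ← mul_assoc, ← mul_assoc, simpleTransposition_comm h]
  split_ifs <;> rfl

theorem leftNil_braid (i : ℤ) :
    leftNil i * leftNil (i + 1) * leftNil i
      = leftNil (i + 1) * leftNil i * leftNil (i + 1) := by
  apply LinearMap.ext
  intro g
  funext w
  have e := congrArg (· * w) (simpleTransposition_braid i)
  simp only [mul_assoc] at e
  simp only [Module.End.mul_apply, leftNil_apply, simpleTransposition_mul_inv_apply,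
    simpleTransposition_left, simpleTransposition_right]
  rw [simpleTransposition_of_ne (i := i) (x := i + 1 + 1) (by omega) (by omega),
    simpleTransposition_of_ne (i := i + 1) (x := i) (by omega) (by omega),
    simpleTransposition_left, simpleTransposition_right, e]
  split_ifs <;> rfl

theorem leftNil_comm_rightNil (i j : ℤ) :
    leftNil j * rightNil i = rightNil i * leftNil j := by
  apply LinearMap.ext
  intro g
  funext w
  simp only [Module.End.mul_apply, leftNil_apply, rightNil_apply,
    mul_inv_rev, simpleTransposition_inv, Equiv.Perm.mul_apply, mul_assoc]
  have hne : w i ≠ w (i + 1) := fun h => by simp at h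
  have hne' : w⁻¹ j ≠ w⁻¹ (j + 1) := fun h => by simp at h
  -- The two conditions interact only when `s_j` exchanges the values of `w` at `i` and `i + 1`.
  have key : ∀ x y : ℤ, w x = y ↔ x = w⁻¹ y := fun x y => by rw [Equiv.Perm.eq_inv_iff_eq]
  have k1 := key i j
  have k2 := key i (j + 1)
  have k3 := key (i + 1) j
  have k4 := key (i + 1) (j + 1)
  simp only [simpleTransposition_apply]
  generalize w i = a at *
  generalize w (i + 1) = b at *
  generalize w⁻¹ j = p at *
  generalize w⁻¹ (j + 1) = q at *
  split_ifs <;> first | rfl | omega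

/-! ### Fans: products of factors `1 + x u_j` with decreasing indices -/

/-- The factor `1 + x u_j`. -/
def nilFactor (j : ℤ) (x : MvPolynomial ℤ ℚ) : Module.End (MvPolynomial ℤ ℚ) PermFun :=
  1 + x • leftNil j

theorem nilFactor_apply (j : ℤ) (x : MvPolynomial ℤ ℚ) (g : PermFun) (w : Equiv.Perm ℤ) :
    nilFactor j x g w = g w + x * leftNil j g w := by
  simp [nilFactor]

theorem nilFactor_mul_self (j : ℤ) (x y : MvPolynomial ℤ ℚ) :
    nilFactor j x * nilFactor j y = nilFactor j (x + y) := by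
  simp only [nilFactor, add_mul, mul_add, one_mul, mul_one, smul_mul_assoc, mul_smul_comm,
    leftNil_mul_self, smul_zero, add_zero, add_smul]
  abel

theorem nilFactor_zero (j : ℤ) : nilFactor j 0 = 1 := by simp [nilFactor]

theorem nilFactor_mul_leftNil_self (j : ℤ) (x : MvPolynomial ℤ ℚ) :
    nilFactor j x * leftNil j = leftNil j := by
  simp [nilFactor, add_mul, leftNil_mul_self]

theorem leftNil_commute_nilFactor {i j : ℤ} (h : i + 1 < j) (x : MvPolynomial ℤ ℚ) :
    Commute (leftNil i) (nilFactor j x) := by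
  simp only [Commute, SemiconjBy, nilFactor, add_mul, mul_add, one_mul, mul_one, smul_mul_assoc,
    mul_smul_comm, leftNil_comm h]

theorem nilFactor_commute {i j : ℤ} (h : i + 1 < j) (x y : MvPolynomial ℤ ℚ) :
    Commute (nilFactor i x) (nilFactor j y) := by
  rw [nilFactor]
  exact (Commute.one_left _).add_left ((leftNil_commute_nilFactor h y).smul_left x)

/-- This expression equals `1 + (x + y) u + x y (u v - v u)` with `u = u_i` and `v = u_{i+1}`, which
is symmetric in `x` and `y`. -/
theorem nilFactor_exchange (i : ℤ) (x y : MvPolynomial ℤ ℚ) :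
    nilFactor (i + 1) (-y) * nilFactor i x * nilFactor (i + 1) y * nilFactor i y
      = nilFactor (i + 1) (-x) * nilFactor i y * nilFactor (i + 1) x * nilFactor i x := by
  have key : ∀ x y : MvPolynomial ℤ ℚ,
      nilFactor (i + 1) (-y) * nilFactor i x * nilFactor (i + 1) y * nilFactor i y
        = 1 + (x + y) • leftNil i + (x * y) • (leftNil i * leftNil (i + 1))
          - (x * y) • (leftNil (i + 1) * leftNil i) := by
    intro x y
    have hu := leftNil_mul_self i
    have hv := leftNil_mul_self (i + 1)
    have hb := leftNil_braid i
    have hu' : ∀ a, a * leftNil i * leftNil i = 0 := fun a => by rw [mul_assoc, hu, mul_zero]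
    have h4 : leftNil (i + 1) * leftNil i * leftNil (i + 1) * leftNil i = 0 := by rw [← hb, hu']
    simp only [nilFactor, add_mul, mul_add, one_mul, mul_one, smul_mul_assoc, mul_smul_comm,
      smul_add, smul_smul, ← mul_assoc, hu, hv, hu', hb, h4, smul_zero, zero_mul]
    module
  rw [key x y, key y x, add_comm y x, mul_comm y x]

/-- The fan `(1 + x u_{a+n-1}) ⋯ (1 + x u_{a+1}) (1 + x u_a)`. -/
def fan (a : ℤ) : ℕ → MvPolynomial ℤ ℚ → Module.End (MvPolynomial ℤ ℚ) PermFun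
  | 0, _ => 1
  | n + 1, x => nilFactor (a + n) x * fan a n x

theorem fan_succ' (a : ℤ) (n : ℕ) (x : MvPolynomial ℤ ℚ) :
    fan a (n + 1) x = fan (a + 1) n x * nilFactor a x := by
  induction n with
  | zero => simp [fan]
  | succ n ih =>
    rw [fan, ih, fan, mul_assoc]
    congr 2
    push_cast
    ring

theorem leftNil_commute_fan {i a : ℤ} (h : i + 1 < a) (n : ℕ) (x : MvPolynomial ℤ ℚ) :
    Commute (leftNil i) (fan a n x) := by
  induction n with
  | zero => exact Commute.one_right _
  | succ n ih => exact (leftNil_commute_nilFactor (by omega) x).mul_right ih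

theorem nilFactor_commute_fan {i a : ℤ} (h : i + 1 < a) (n : ℕ) (x y : MvPolynomial ℤ ℚ) :
    Commute (nilFactor i x) (fan a n y) := by
  induction n with
  | zero => exact Commute.one_right _
  | succ n ih => exact (nilFactor_commute (by omega) x y).mul_right ih

theorem rightNil_commute_fan (i a : ℤ) (n : ℕ) (x : MvPolynomial ℤ ℚ) :
    Commute (rightNil i) (fan a n x) := by
  induction n with
  | zero => exact Commute.one_right _
  | succ n ih =>
    refine Commute.mul_right ?_ ih
    rw [nilFactor]
    refine (Commute.one_right _).add_right (Commute.smul_right ?_ x)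
    exact (leftNil_comm_rightNil i _).symm

/-- Fans with the same indices commute, by induction on the number of factors: removing the smallest
index from both fans leaves an expression that `nilFactor_exchange` shows to be symmetric. -/
theorem fan_commute (a : ℤ) (n : ℕ) (x y : MvPolynomial ℤ ℚ) :
    Commute (fan a n x) (fan a n y) := by
  induction n generalizing a with
  | zero => exact Commute.one_right _
  | succ n ih =>
    cases n with
    | zero =>
      simp only [Commute, SemiconjBy, fan, mul_one, nilFactor_mul_self, add_comm]
    | succ n =>
      have key : ∀ x y : MvPolynomial ℤ ℚ, fan a (n + 2) x * fan a (n + 2) y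
          = fan (a + 1) (n + 1) x * fan (a + 1) (n + 1) y *
            (nilFactor (a + 1) (-y) * nilFactor a x * nilFactor (a + 1) y * nilFactor a y) := by
        intro x y
        have h1 : fan (a + 1 + 1) n y = fan (a + 1) (n + 1) y * nilFactor (a + 1) (-y) := by
          rw [fan_succ', mul_assoc, nilFactor_mul_self, add_neg_cancel, nilFactor_zero, mul_one]
        calc fan a (n + 2) x * fan a (n + 2) y
            = fan (a + 1) (n + 1) x * (nilFactor a x * fan (a + 1 + 1) n y) *
                nilFactor (a + 1) y * nilFactor a y := by
              rw [fan_succ' a (n + 1) x, fan_succ' a (n + 1) y, fan_succ' (a + 1) n y]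
              simp only [mul_assoc]
          _ = _ := by
              rw [(nilFactor_commute_fan (by omega) n x y).eq, h1]
              simp only [mul_assoc]
      rw [Commute, SemiconjBy, key x y, key y x, nilFactor_exchange, (ih (a + 1)).eq]

/-! ### The families of Schubert polynomials -/

open Classical in
/-- The indicator function of the identity permutation. -/
def identityIndicator : PermFun := fun w => if w = 1 then 1 else 0

/-- The Schubert polynomials of the permutations of `{a, …, a + n}`, in the variables
`x_a, …, x_{a+n-1}`, as the coefficients of the product of the fans with indices
`j, …, a + n - 1` and argument `x_j`, for `j = a, …, a + n - 1`. -/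
def schubertFamily (a : ℤ) : ℕ → PermFun
  | 0 => identityIndicator
  | n + 1 => fan a (n + 1) (MvPolynomial.X a) (schubertFamily (a + 1) n)

/-- The exchange of `x_i` and `x_{i+1}` in all members of a family. -/
def swapFamily (i : ℤ) (g : PermFun) : PermFun := fun w => swapVars i (g w)

theorem swapFamily_nilFactor (i j : ℤ) (x : MvPolynomial ℤ ℚ) (g : PermFun) :
    swapFamily i (nilFactor j x g) = nilFactor j (swapVars i x) (swapFamily i g) := by
  funext w
  simp only [swapFamily, nilFactor_apply, leftNil_apply, swapVars, map_add, map_mul]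
  split_ifs <;> simp

theorem swapFamily_fan (i a : ℤ) (n : ℕ) (x : MvPolynomial ℤ ℚ) (g : PermFun) :
    swapFamily i (fan a n x g) = fan a n (swapVars i x) (swapFamily i g) := by
  induction n with
  | zero => rfl
  | succ n ih => rw [fan, fan, Module.End.mul_apply, swapFamily_nilFactor, ih]; rfl

theorem swapFamily_identityIndicator (i : ℤ) :
    swapFamily i identityIndicator = identityIndicator := by
  funext w
  simp only [swapFamily, identityIndicator, swapVars]
  split_ifs <;> simp

theorem swapFamily_schubertFamily {i a : ℤ} (h : i + 1 < a) (n : ℕ) :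
    swapFamily i (schubertFamily a n) = schubertFamily a n := by
  induction n generalizing a with
  | zero => exact swapFamily_identityIndicator i
  | succ n ih =>
    rw [schubertFamily, swapFamily_fan, ih (by omega), swapVars_X,
      simpleTransposition_of_ne (by omega) (by omega)]

theorem rightNil_identityIndicator (i : ℤ) :
    rightNil i identityIndicator = leftNil i identityIndicator := by
  funext w
  rw [rightNil_apply, leftNil_apply]
  by_cases hw : w = simpleTransposition i
  · subst hw
    simp [simpleTransposition_left, simpleTransposition_right, identityIndicator]
  · have h1 : w * simpleTransposition i ≠ 1 := fun h => hw (by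
      rw [← mul_simpleTransposition_cancel i w, h, one_mul])
    have h2 : simpleTransposition i * w ≠ 1 := fun h => hw (by
      rw [← simpleTransposition_mul_cancel i w, h, mul_one])
    simp [identityIndicator, h1, h2]

theorem rightNil_schubertFamily {i a : ℤ} (h : i + 1 < a) (n : ℕ) :
    rightNil i (schubertFamily a n) = leftNil i (schubertFamily a n) := by
  induction n generalizing a with
  | zero => exact rightNil_identityIndicator i
  | succ n ih =>
    rw [schubertFamily, ← Module.End.mul_apply, (rightNil_commute_fan i a _ _).eq,
      Module.End.mul_apply, ih (by omega), ← Module.End.mul_apply, ← Module.End.mul_apply,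
      (leftNil_commute_fan h _ _).eq]

/-- The divided difference of a product of two consecutive fans. Since
`fan a (n + 2) x * fan a (n + 2) y` is symmetric in `x` and `y`, only the correction factor
`1 - y u_a`, which turns the second of these fans into `fan (a + 1) (n + 1) y`, contributes. -/
theorem fan_mul_fan_sub (a : ℤ) (n : ℕ) (x y : MvPolynomial ℤ ℚ) (g : PermFun) :
    fan a (n + 1) x (fan (a + 1) n y g) - fan a (n + 1) y (fan (a + 1) n x g)
      = (x - y) • fan a (n + 1) x (fan (a + 1) n y (leftNil a g)) := by
  have h1 : ∀ y : MvPolynomial ℤ ℚ, fan (a + 1) n y = fan a (n + 1) y * nilFactor a (-y) :=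
    fun y => by
      rw [fan_succ', mul_assoc, nilFactor_mul_self, add_neg_cancel, nilFactor_zero, mul_one]
  have h2 : fan (a + 1) n y (leftNil a g) = fan a (n + 1) y (leftNil a g) := by
    rw [fan_succ', Module.End.mul_apply, ← Module.End.mul_apply (nilFactor a y),
      nilFactor_mul_leftNil_self]
  rw [h2]
  simp only [← Module.End.mul_apply]
  have h3 : nilFactor a (-y) - nilFactor a (-x) = (x - y) • leftNil a := by
    simp only [nilFactor]
    module
  rw [h1 y, h1 x, ← mul_assoc, ← mul_assoc, (fan_commute a (n + 1) y x).eq, ← LinearMap.sub_apply,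
    ← mul_sub, h3, mul_smul_comm, LinearMap.smul_apply, mul_assoc]

theorem schubertFamily_sub_swapFamily {a i : ℤ} {n : ℕ} (h1 : a ≤ i) (h2 : i < a + n) :
    schubertFamily a n - swapFamily i (schubertFamily a n)
      = (MvPolynomial.X i - MvPolynomial.X (i + 1) : MvPolynomial ℤ ℚ) •
        rightNil i (schubertFamily a n) := by
  induction n generalizing a with
  | zero => simp at h2; omega
  | succ n ih =>
    rcases h1.lt_or_eq with h1 | rfl
    · rw [schubertFamily, swapFamily_fan, swapVars_X,
        simpleTransposition_of_ne (by omega) (by omega), ← map_sub,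
        ih (by omega) (by push_cast at h2; omega), map_smul, ← Module.End.mul_apply,
        ← Module.End.mul_apply, (rightNil_commute_fan i a _ _).eq]
    · cases n with
      | zero =>
        have := fan_mul_fan_sub a 0 (MvPolynomial.X a) (MvPolynomial.X (a + 1)) identityIndicator
        simp only [fan, Module.End.one_apply, Nat.cast_zero, add_zero, mul_one] at this
        rw [schubertFamily, swapFamily_fan, swapVars_X, simpleTransposition_left, schubertFamily,
          swapFamily_identityIndicator]
        simp only [fan, Nat.cast_zero, add_zero, mul_one]
        rw [this, ← rightNil_identityIndicator, ← Module.End.mul_apply, ← Module.End.mul_apply]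
        have hc := rightNil_commute_fan a a 1 (MvPolynomial.X a)
        simp only [fan, Nat.cast_zero, add_zero, mul_one] at hc
        rw [hc.eq]
      | succ n =>
        rw [schubertFamily, schubertFamily, swapFamily_fan, swapFamily_fan, swapVars_X, swapVars_X,
          simpleTransposition_left, simpleTransposition_right,
          swapFamily_schubertFamily (by omega), fan_mul_fan_sub,
          ← rightNil_schubertFamily (by omega)]
        simp only [← Module.End.mul_apply]
        rw [(rightNil_commute_fan a (a + 1) _ _).symm.eq, ← mul_assoc,
          (rightNil_commute_fan a a _ _).symm.eq, mul_assoc]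

/-- The recursion that characterizes Schubert polynomials: `∂_i` sends the member indexed by `w` to
the one indexed by `w s_i` if `w s_i` is shorter than `w`, and to `0` otherwise. -/
theorem dividedDifference_schubertFamily {a i : ℤ} {n : ℕ} (h1 : a ≤ i) (h2 : i < a + n)
    (w : Equiv.Perm ℤ) :
    dividedDifference i (schubertFamily a n w)
      = if w (i + 1) < w i then schubertFamily a n (w * simpleTransposition i) else 0 :=
  dividedDifference_eq_of_eq (congrFun (schubertFamily_sub_swapFamily h1 h2) w)

/-! ### Vanishing and stability of the families -/

/-- `w` fixes every integer greater than `c`. -/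
def FixesAbove (c : ℤ) (w : Equiv.Perm ℤ) : Prop := ∀ x : ℤ, c < x → w x = x

theorem FixesOutside.fixesAbove {p q c : ℤ} {w : Equiv.Perm ℤ} (h : FixesOutside p q w)
    (hc : q ≤ c) : FixesAbove c w := fun x hx => h x (by omega)

theorem FixesAbove.inv_lt {c j : ℤ} {w : Equiv.Perm ℤ} (h : FixesAbove c w) (hj : c ≤ j) :
    ¬ w⁻¹ (j + 1) < w⁻¹ j := by
  have h1 : w⁻¹ (j + 1) = j + 1 := by rw [Equiv.Perm.inv_eq_iff_eq, h _ (by omega)]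
  intro hlt
  have h2 := h (w⁻¹ j) (by omega)
  rw [show w (w⁻¹ j) = j from w.apply_symm_apply j] at h2
  omega

theorem FixesAbove.simpleTransposition_mul {c j : ℤ} {w : Equiv.Perm ℤ} (h : FixesAbove c w)
    (hj : j + 1 ≤ c) : FixesAbove c (simpleTransposition j * w) := fun x hx => by
  rw [Equiv.Perm.mul_apply, h x hx, simpleTransposition_of_ne (by omega) (by omega)]

/-- The factors whose indices are too large to be left descents of `w` have no effect at `w`. -/
theorem fan_add_apply {a c : ℤ} {d : ℕ} {w : Equiv.Perm ℤ} (h : FixesAbove c w) (hc : c ≤ a + d)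
    (e : ℕ) (x : MvPolynomial ℤ ℚ) (g : PermFun) : fan a (d + e) x g w = fan a d x g w := by
  induction e with
  | zero => rfl
  | succ e ih =>
    rw [← add_assoc, fan, Module.End.mul_apply, nilFactor_apply, leftNil_apply,
      if_neg (h.inv_lt (by push_cast; omega)), mul_zero, add_zero, ih]

theorem fan_congr {a c : ℤ} {n : ℕ} (hc : a + n ≤ c) (x : MvPolynomial ℤ ℚ) {g g' : PermFun}
    (hg : ∀ w, FixesAbove c w → g w = g' w) {w : Equiv.Perm ℤ} (hw : FixesAbove c w) :
    fan a n x g w = fan a n x g' w := by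
  induction n generalizing w with
  | zero => exact hg w hw
  | succ n ih =>
    push_cast at hc
    simp only [fan, Module.End.mul_apply, nilFactor_apply, leftNil_apply]
    rw [ih (by omega) hw, ih (by omega) (hw.simpleTransposition_mul (by omega))]

theorem schubertFamily_succ_apply {a : ℤ} {n : ℕ} {w : Equiv.Perm ℤ} (hw : FixesAbove (a + n) w) :
    schubertFamily a (n + 1) w = schubertFamily a n w := by
  induction n generalizing a w with
  | zero =>
    exact fan_add_apply (d := 0) hw le_rfl 1 _ _
  | succ n ih =>
    rw [schubertFamily, fan_add_apply hw le_rfl, schubertFamily]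
    refine fan_congr le_rfl _ (fun v hv => ih ?_) hw
    intro x hx
    exact hv x (by push_cast; omega)

theorem schubertFamily_add_apply {a : ℤ} {n : ℕ} {w : Equiv.Perm ℤ} (hw : FixesAbove (a + n) w)
    (e : ℕ) : schubertFamily a (n + e) w = schubertFamily a n w := by
  induction e with
  | zero => rfl
  | succ e ih =>
    rw [← add_assoc, schubertFamily_succ_apply (fun x hx => hw x (by push_cast at hx; omega)), ih]

theorem schubertFamily_apply_eq {a : ℤ} {n n' : ℕ} {w : Equiv.Perm ℤ}
    (hw : FixesAbove (a + n) w) (hw' : FixesAbove (a + n') w) :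
    schubertFamily a n w = schubertFamily a n' w := by
  rcases le_total n n' with h | h
  · obtain ⟨e, rfl⟩ := Nat.exists_eq_add_of_le h
    exact (schubertFamily_add_apply hw e).symm
  · obtain ⟨e, rfl⟩ := Nat.exists_eq_add_of_le h
    exact schubertFamily_add_apply hw' e

theorem fan_apply_eq_zero_of_ne {a x : ℤ} (hx : x < a) (n : ℕ) (y : MvPolynomial ℤ ℚ) {g : PermFun}
    (hg : ∀ w : Equiv.Perm ℤ, w x ≠ x → g w = 0) {w : Equiv.Perm ℤ} (hw : w x ≠ x) :
    fan a n y g w = 0 := by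
  induction n generalizing w with
  | zero => exact hg w hw
  | succ n ih =>
    have h1 : (simpleTransposition (a + n) * w) x ≠ x := by
      rw [Equiv.Perm.mul_apply, simpleTransposition_apply]
      split_ifs <;> omega
    rw [fan, Module.End.mul_apply, nilFactor_apply, leftNil_apply, ih hw, ih h1]
    simp

theorem schubertFamily_eq_zero {a x : ℤ} (hx : x < a) (n : ℕ) {w : Equiv.Perm ℤ} (hw : w x ≠ x) :
    schubertFamily a n w = 0 := by
  induction n generalizing a w with
  | zero =>
    rw [schubertFamily, identityIndicator, if_neg]
    rintro rfl
    exact hw rfl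
  | succ n ih => exact fan_apply_eq_zero_of_ne hx _ _ (fun v hv => ih (by omega) hv) hw

theorem schubertFamily_one (a : ℤ) (n : ℕ) : schubertFamily a n 1 = 1 := by
  have := schubertFamily_add_apply (a := a) (n := 0) (w := 1) (fun x _ => rfl) n
  rw [zero_add] at this
  rw [this, schubertFamily, identityIndicator, if_pos rfl]

theorem coeff_fan_of_eq_zero {a b : ℤ} {γ : ℤ →₀ ℕ} (hγ : γ b = 0) (n : ℕ) (g : PermFun)
    (w : Equiv.Perm ℤ) :
    MvPolynomial.coeff γ (fan a n (MvPolynomial.X b) g w) = MvPolynomial.coeff γ (g w) := by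
  induction n with
  | zero => rfl
  | succ n ih =>
    rw [fan, Module.End.mul_apply, nilFactor_apply, MvPolynomial.coeff_add,
      MvPolynomial.coeff_X_mul', if_neg (by simpa using hγ), add_zero, ih]

/-- Stability: additional variables on the left do not affect the coefficients of the monomials
in which they do not occur. -/
theorem coeff_schubertFamily_of_eq_zero {a : ℤ} {n t : ℕ} {γ : ℤ →₀ ℕ}
    (hγ : ∀ j < a, γ j = 0) (w : Equiv.Perm ℤ) :
    MvPolynomial.coeff γ (schubertFamily (a - t) (n + t) w)
      = MvPolynomial.coeff γ (schubertFamily a n w) := by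
  induction t with
  | zero => simp
  | succ t ih =>
    have e : a - ((t + 1 : ℕ) : ℤ) + 1 = a - t := by push_cast; ring
    rw [← add_assoc, schubertFamily, coeff_fan_of_eq_zero (hγ _ (by push_cast; omega)), e, ih]

theorem coeff_fan_eq_zero {a b j : ℤ} (hj : j ≠ b) {γ : ℤ →₀ ℕ} (hγ : γ j ≠ 0) (n : ℕ) {g : PermFun}
    (hg : ∀ (γ : ℤ →₀ ℕ) (w : Equiv.Perm ℤ), γ j ≠ 0 → MvPolynomial.coeff γ (g w) = 0)
    (w : Equiv.Perm ℤ) : MvPolynomial.coeff γ (fan a n (MvPolynomial.X b) g w) = 0 := by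
  induction n generalizing w γ with
  | zero => exact hg γ w hγ
  | succ n ih =>
    have h1 : (γ - Finsupp.single b 1 : ℤ →₀ ℕ) j ≠ 0 := by
      rwa [Finsupp.tsub_apply, Finsupp.single_apply, if_neg (Ne.symm hj), tsub_zero]
    rw [fan, Module.End.mul_apply, nilFactor_apply, MvPolynomial.coeff_add,
      MvPolynomial.coeff_X_mul', ih hγ, leftNil_apply]
    split_ifs
    · rw [ih h1, add_zero]
    all_goals simp

theorem coeff_schubertFamily_eq_zero {a j : ℤ} (hj : j < a) (n : ℕ) {γ : ℤ →₀ ℕ} (hγ : γ j ≠ 0)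
    (w : Equiv.Perm ℤ) : MvPolynomial.coeff γ (schubertFamily a n w) = 0 := by
  induction n generalizing a γ w with
  | zero =>
    rw [schubertFamily, identityIndicator]
    split_ifs
    · rw [MvPolynomial.coeff_one, if_neg]
      rintro rfl
      exact hγ rfl
    · simp
  | succ n ih =>
    exact coeff_fan_eq_zero hj.ne hγ _ (fun δ v hδ => ih (by omega) hδ v) w

open Classical in
theorem constantCoeff_schubertFamily (a : ℤ) (n : ℕ) (w : Equiv.Perm ℤ) :
    MvPolynomial.coeff 0 (schubertFamily a n w) = if w = 1 then 1 else 0 := by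
  have := coeff_schubertFamily_of_eq_zero (a := a + n) (n := 0) (t := n) (γ := 0)
    (fun _ _ => rfl) w
  rw [zero_add, add_sub_cancel_right] at this
  rw [this, schubertFamily, identityIndicator]
  split_ifs <;> simp

/-! ### Translation -/

theorem shift_apply (N : ℕ) (w : Equiv.Perm ℤ) (x : ℤ) : shift N w x = w (x - N) + N := by
  simp [shift, sub_eq_add_neg]

theorem shift_inv_apply (N : ℕ) (w : Equiv.Perm ℤ) (x : ℤ) :
    (shift N w)⁻¹ x = w⁻¹ (x - N) + N := by
  rw [Equiv.Perm.inv_eq_iff_eq, shift_apply]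
  simp

theorem simpleTransposition_mul_shift (N : ℕ) (j : ℤ) (w : Equiv.Perm ℤ) :
    simpleTransposition j * shift N w = shift N (simpleTransposition (j - N) * w) := by
  ext x
  simp only [Equiv.Perm.mul_apply, shift_apply, simpleTransposition_apply]
  split_ifs <;> omega

theorem shift_eq_one_iff (N : ℕ) (w : Equiv.Perm ℤ) : shift N w = 1 ↔ w = 1 := by
  constructor
  · intro h
    ext x
    have := congrArg (fun v : Equiv.Perm ℤ => v (x + N)) h
    simpa [shift_apply] using this
  · rintro rfl
    ext x
    simp [shift_apply]

theorem FixesOutside.shift {p q : ℤ} {w : Equiv.Perm ℤ} (h : FixesOutside p q w) (N : ℕ) :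
    FixesOutside (p + N) (q + N) (shift N w) := fun x hx => by
  rw [shift_apply, h _ (by omega), sub_add_cancel]

/-- The family `g` with its index and its variables translated by `-N`. -/
def translateFamily (N : ℕ) (g : PermFun) : PermFun := fun w =>
  MvPolynomial.rename (fun i : ℤ => i - (N : ℤ)) (g (shift N w))

theorem translateFamily_fan (N : ℕ) (a b : ℤ) (n : ℕ) (g : PermFun) :
    translateFamily N (fan a n (MvPolynomial.X b) g)
      = fan (a - N) n (MvPolynomial.X (b - N)) (translateFamily N g) := by
  induction n with
  | zero => rfl
  | succ n ih =>
    funext w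
    rw [fan, fan, Module.End.mul_apply, Module.End.mul_apply, ← ih, nilFactor_apply, leftNil_apply]
    simp only [translateFamily, nilFactor_apply, leftNil_apply, shift_inv_apply,
      simpleTransposition_mul_shift, map_add, map_mul, MvPolynomial.rename_X]
    have e1 : a + (n : ℤ) + 1 - N = a - N + n + 1 := by ring
    have e2 : a + (n : ℤ) - N = a - N + n := by ring
    rw [e1, e2]
    simp only [add_lt_add_iff_right]
    split_ifs <;> simp

theorem translateFamily_schubertFamily (N : ℕ) (a : ℤ) (n : ℕ) :
    translateFamily N (schubertFamily a n) = schubertFamily (a - N) n := by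
  induction n generalizing a with
  | zero =>
    funext w
    simp only [translateFamily, schubertFamily, identityIndicator]
    by_cases h : w = 1
    · rw [if_pos h, if_pos ((shift_eq_one_iff N w).2 h), map_one]
    · rw [if_neg h, if_neg (mt (shift_eq_one_iff N w).1 h), map_zero]
  | succ n ih =>
    rw [schubertFamily, translateFamily_fan, ih, schubertFamily]
    congr 2
    ring

/-! ### The longest permutation and the staircase monomial -/

/-- The permutation reversing the interval `[p, q]` and fixing all other integers. -/
def intervalReversal (p q : ℤ) : Equiv.Perm ℤ :=
  Function.Involutive.toPerm (fun x : ℤ => if p ≤ x ∧ x ≤ q then p + q - x else x)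
    (by intro x; dsimp only; split_ifs <;> omega)

theorem intervalReversal_apply (p q x : ℤ) :
    intervalReversal p q x = if p ≤ x ∧ x ≤ q then p + q - x else x := rfl

theorem longestPerm_eq (n : ℕ) : longestPerm n = intervalReversal 1 n := by
  ext x
  rw [intervalReversal_apply]
  change (if 1 ≤ x ∧ x ≤ n then (n : ℤ) + 1 - x else x) = _
  split_ifs <;> omega

/-- The cycle `s_a s_{a+1} ⋯ s_{a+d-1}`. -/
def ascendingCycle (a : ℤ) : ℕ → Equiv.Perm ℤ
  | 0 => 1
  | d + 1 => ascendingCycle a d * simpleTransposition (a + d)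

theorem ascendingCycle_apply (a : ℤ) (d : ℕ) (x : ℤ) :
    ascendingCycle a d x
      = if x = a + d then a else if a ≤ x ∧ x < a + d then x + 1 else x := by
  induction d generalizing x with
  | zero =>
    simp only [ascendingCycle, Equiv.Perm.coe_one, id_eq, Nat.cast_zero, add_zero]
    split_ifs <;> omega
  | succ d ih =>
    rw [ascendingCycle, Equiv.Perm.mul_apply, ih, simpleTransposition_apply]
    push_cast
    split_ifs <;> omega

theorem ascendingCycle_mul_intervalReversal (a : ℤ) (d : ℕ) :
    ascendingCycle a d * intervalReversal a (a + d) = intervalReversal (a + 1) (a + d) := by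
  ext x
  rw [Equiv.Perm.mul_apply, ascendingCycle_apply, intervalReversal_apply, intervalReversal_apply]
  split_ifs <;> omega

theorem fan_apply_eq_zero_of_lt {a : ℤ} (d : ℕ) (x : MvPolynomial ℤ ℚ) {g : PermFun}
    (hg : ∀ w : Equiv.Perm ℤ, w a ≠ a → g w = 0) {w : Equiv.Perm ℤ} (hw : a + d < w a) :
    fan a d x g w = 0 := by
  induction d generalizing w with
  | zero => exact hg w (by push_cast at hw; omega)
  | succ d ih =>
    push_cast at hw
    have h1 : a + d < (simpleTransposition (a + d) * w) a := by
      rw [Equiv.Perm.mul_apply, simpleTransposition_of_ne (by omega) (by omega)]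
      omega
    rw [fan, Module.End.mul_apply, nilFactor_apply, leftNil_apply, ih h1, ih (by omega)]
    simp

/-- If `w` maps `a` to `a + d`, only the product of all generators in the fan can bring the value at
`a` back to `a`. -/
theorem fan_apply_of_apply_eq {a : ℤ} {d : ℕ} (x : MvPolynomial ℤ ℚ) {g : PermFun}
    (hg : ∀ w : Equiv.Perm ℤ, w a ≠ a → g w = 0) {w : Equiv.Perm ℤ} (hw : w a = a + d)
    (hw' : ∀ y < a, w y = y) : fan a d x g w = x ^ d * g (ascendingCycle a d * w) := by
  induction d generalizing w with
  | zero => simp [fan, ascendingCycle]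
  | succ d ih =>
    push_cast at hw
    have h1 : (simpleTransposition (a + d) * w) a = a + d := by
      rw [Equiv.Perm.mul_apply, hw, ← add_assoc, simpleTransposition_right]
    have h2 : ∀ y < a, (simpleTransposition (a + d) * w) y = y := fun y hy => by
      rw [Equiv.Perm.mul_apply, hw' y hy, simpleTransposition_of_ne (by omega) (by omega)]
    have h3 : w⁻¹ (a + d + 1) = a := by rw [Equiv.Perm.inv_eq_iff_eq, hw, add_assoc]
    have h4 : w⁻¹ (a + d + 1) < w⁻¹ (a + d) := by
      rw [h3]
      by_contra hc
      rcases lt_or_eq_of_le (not_lt.1 hc) with h | h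
      · have := hw' _ h
        rw [show w (w⁻¹ (a + d)) = a + d from w.apply_symm_apply _] at this
        omega
      · rw [Equiv.Perm.inv_eq_iff_eq] at h
        omega
    rw [fan, Module.End.mul_apply, nilFactor_apply, leftNil_apply, if_pos h4, ih h1 h2,
      fan_apply_eq_zero_of_lt d x hg (by omega), zero_add, ascendingCycle, mul_assoc, pow_succ]
    ring

theorem schubertFamily_intervalReversal (a : ℤ) {d n : ℕ} (h : d ≤ n) :
    schubertFamily a n (intervalReversal a (a + d))
      = ∏ i ∈ Finset.range d, MvPolynomial.X (a + i) ^ (d - i) := by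
  induction d generalizing a n with
  | zero =>
    have : intervalReversal a (a + (0 : ℕ)) = 1 := by
      ext x
      rw [intervalReversal_apply, Equiv.Perm.one_apply]
      push_cast
      split_ifs <;> omega
    rw [this, schubertFamily_one, Finset.prod_range_zero]
  | succ d ih =>
    obtain ⟨e, rfl⟩ := Nat.exists_eq_add_of_le h
    have e1 : d + 1 + e = d + e + 1 := by omega
    have e2 : a + ((d + 1 : ℕ) : ℤ) = a + 1 + (d : ℤ) := by push_cast; ring
    have h1 : FixesAbove (a + ((d + 1 : ℕ) : ℤ))
        (intervalReversal a (a + ((d + 1 : ℕ) : ℤ))) := fun x hx => by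
      rw [intervalReversal_apply, if_neg (by omega)]
    rw [e1, schubertFamily, ← e1, fan_add_apply h1 le_rfl,
      fan_apply_of_apply_eq _ (fun w hw => schubertFamily_eq_zero (lt_add_one a) _ hw),
      ascendingCycle_mul_intervalReversal, e2, ih (a + 1) (by omega), Finset.prod_range_succ']
    · rw [mul_comm]
      congr 1
      · refine Finset.prod_congr rfl fun i _ => ?_
        rw [Nat.add_sub_add_right]
        congr 2
        push_cast
        ring
      · simp
    · rw [intervalReversal_apply, if_pos (by omega)]
      ring
    · intro y hy
      rw [intervalReversal_apply, if_neg (by omega)]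

/-- The initial value of the recursion `dividedDifference_schubertFamily`. -/
theorem schubertFamily_longestPerm (n : ℕ) :
    schubertFamily 1 (n - 1) (longestPerm n) = staircaseMonomial n := by
  cases n with
  | zero =>
    have : longestPerm 0 = 1 := by
      ext x
      rw [longestPerm_eq, intervalReversal_apply, Equiv.Perm.one_apply]
      push_cast
      split_ifs <;> omega
    rw [this, schubertFamily_one]
    simp [staircaseMonomial]
  | succ m =>
    have := schubertFamily_intervalReversal 1 (le_refl m)
    rw [longestPerm_eq, Nat.add_sub_cancel, Nat.cast_succ, add_comm (m : ℤ) 1, this,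
      staircaseMonomial, Finset.prod_range_succ]
    simp only [Nat.add_sub_cancel, Nat.sub_self, pow_zero, mul_one]
    exact Finset.prod_congr rfl fun i _ => by rw [add_comm]

/-! ### Identification of Schubert and back stable Schubert polynomials -/

/-- Along any reduced decomposition of `g`, each divided difference is taken at a descent, so that
the recursion `dividedDifference_schubertFamily` applies. -/
theorem foldr_dividedDifference {n : ℕ} {l : List ℤ} {g : Equiv.Perm ℤ}
    (hl : IsReducedDecomposition l g) (hg : FixesOutside 1 n g) :
    l.foldr dividedDifference (staircaseMonomial n)
      = schubertFamily 1 (n - 1) (longestPerm n * g⁻¹) := by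
  induction l generalizing g with
  | nil =>
    have : g = 1 := by simpa using hl.1.symm
    rw [this, inv_one, mul_one, schubertFamily_longestPerm, List.foldr_nil]
  | cons i l ih =>
    obtain ⟨htail, hdesc⟩ := hl.tail
    have hi : 1 ≤ i ∧ i + 1 ≤ n := by
      by_contra hc
      by_cases h1 : 1 ≤ i ∧ i ≤ n
      · have := hg.inv.mem h1
        have := hg.inv (i + 1) (by omega)
        omega
      · have := hg.inv i h1
        by_cases h2 : 1 ≤ i + 1 ∧ i + 1 ≤ n
        · have := hg.inv.mem h2
          omega
        · have := hg.inv (i + 1) h2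
          omega
    have h1 := hg.inv.mem (x := i) (by omega)
    have h2 := hg.inv.mem (x := i + 1) (by omega)
    rw [List.foldr_cons, ih htail ((FixesOutside.simpleTransposition hi.1 hi.2).mul hg),
      dividedDifference_schubertFamily hi.1 (by omega), mul_inv_rev, simpleTransposition_inv,
      ← mul_assoc, mul_simpleTransposition_cancel, if_pos]
    rw [longestPerm_eq]
    simp only [Equiv.Perm.mul_apply, simpleTransposition_left, simpleTransposition_right,
      intervalReversal_apply]
    rw [if_pos h1, if_pos h2]
    omega

/-- Schubert polynomials are members of the families, whatever choices their definition makes. -/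
theorem schubert_eq {w : Equiv.Perm ℤ} {m : ℕ} (hw : FixesOutside 1 (1 + m) w) :
    schubert w = schubertFamily 1 m w := by
  have h0 : ∀ n : ℕ, FixesOutside 1 n (longestPerm n) := fun n x hx => by
    rw [longestPerm_eq, intervalReversal_apply, if_neg hx]
  have hex : ∃ p : ℕ × List ℤ,
      IsPermOfSize p.1 w ∧ IsReducedDecomposition p.2 (w⁻¹ * longestPerm p.1) := by
    obtain ⟨l, hl⟩ := (hw.inv.isFinitary.mul (h0 (1 + m)).isFinitary).exists_isReducedDecomposition
    exact ⟨(1 + m, l), by simpa [IsPermOfSize, FixesOutside] using hw, hl⟩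
  rw [schubert, dif_pos hex]
  obtain ⟨h1, h2⟩ := hex.choose_spec
  set n := hex.choose.1
  have h1' : FixesOutside 1 n w := h1
  rw [foldr_dividedDifference h2 (h1'.inv.mul (h0 n)), mul_inv_rev, inv_inv, mul_inv_cancel_left]
  exact schubertFamily_apply_eq (h1'.fixesAbove (by omega)) (hw.fixesAbove le_rfl)

/-- The limit defining a back stable Schubert polynomial is attained: the coefficient of `x^γ` can
be computed in any family whose first variable does not come after the first variable of `x^γ`. -/
theorem coeff_backStableSchubert {p q a : ℤ} {n : ℕ} {w : Equiv.Perm ℤ} {γ : ℤ →₀ ℕ}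
    (hw : FixesOutside p q w) (hγ : ∀ j < a, γ j = 0) (hn : q ≤ a + n) :
    MvPowerSeries.coeff γ (backStableSchubert w) = MvPolynomial.coeff γ (schubertFamily a n w) := by
  change stableValue atTop _ = _
  apply stableValue_eq
  filter_upwards [eventually_ge_atTop (1 - p).toNat, eventually_ge_atTop (1 - a).toNat] with N h1 h2
  obtain ⟨t, ht⟩ : ∃ t : ℕ, (t : ℤ) = a - (1 - N) := ⟨(a - (1 - N)).toNat, by omega⟩
  rw [schubert_eq (m := n + t) ((hw.shift N).mono (by omega) (by push_cast; omega)),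
    ← coeff_schubertFamily_of_eq_zero (t := t) hγ w]
  have := congrFun (translateFamily_schubertFamily N 1 (n + t)) w
  rw [translateFamily] at this
  rw [this, show (1 : ℤ) - N = a - t by omega]

/-! ### Linear independence -/

open Classical in
/-- Extraction of the coefficient of one Schubert polynomial: the constant term of the divided
differences along a reduced decomposition of `w`. -/
theorem exists_dual_schubertFamily {a : ℤ} {n : ℕ} {w : Equiv.Perm ℤ}
    (hw : FixesOutside a (a + n) w) :
    ∃ φ : MvPolynomial ℤ ℚ →ₗ[ℚ] ℚ, ∀ u : Equiv.Perm ℤ,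
      φ (schubertFamily a n u) = if u = w then 1 else 0 := by
  induction h : length w using Nat.strong_induction_on generalizing w with
  | _ m ih =>
    by_cases h1 : w = 1
    · subst h1
      exact ⟨MvPolynomial.lcoeff ℚ 0, fun u => constantCoeff_schubertFamily a n u⟩
    · obtain ⟨i, hi1, hi2, hi3⟩ := hw.exists_descent h1
      have hlen := length_mul_simpleTransposition_of_descent hw.isFinitary hi3
      obtain ⟨φ, hφ⟩ := ih _ (by omega)
        (hw.mul (FixesOutside.simpleTransposition hi1 hi2)) rfl
      refine ⟨φ ∘ₗ dividedDifferenceLinear i, fun u => ?_⟩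
      change φ (dividedDifference i (schubertFamily a n u)) = _
      rw [dividedDifference_schubertFamily hi1 (by omega)]
      by_cases hu : u = w
      · rw [if_pos hu, hu, if_pos hi3, hφ, if_pos rfl]
      · rw [if_neg hu]
        split_ifs
        · rw [hφ, if_neg]
          exact fun h => hu (mul_right_cancel h)
        · exact map_zero φ

theorem linearIndepOn_backStableSchubert :
    LinearIndepOn ℚ backStableSchubert {u : Equiv.Perm ℤ | IsFinitary u} := by
  rw [linearIndepOn_iff]
  intro c hc h0
  ext w
  by_contra hw
  have hfin : ∀ u ∈ c.support, IsFinitary u := fun u hu => hc hu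
  -- An interval outside of which all permutations in question are the identity.
  obtain ⟨p, q, hpq⟩ : ∃ p q : ℤ, ∀ u ∈ c.support, FixesOutside p q u := by
    clear hw h0 hc
    revert hfin
    generalize c.support = s
    classical
    induction s using Finset.induction_on with
    | empty => exact fun _ => ⟨0, 0, by simp⟩
    | insert u s _ ih =>
      intro h
      obtain ⟨p, q, h1⟩ := ih fun v hv => h v (Finset.mem_insert_of_mem hv)
      obtain ⟨p', q', h2⟩ := (h u (Finset.mem_insert_self u s)).exists_fixesOutside
      refine ⟨min p p', max q q', fun v hv => ?_⟩
      rcases Finset.mem_insert.1 hv with rfl | hv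
      · exact h2.mono (min_le_right _ _) (le_max_right _ _)
      · exact (h1 v hv).mono (min_le_left _ _) (le_max_left _ _)
  set n := (q - p).toNat
  have hsum : ∑ u ∈ c.support, c u • schubertFamily p n u = 0 := by
    ext γ
    rw [MvPolynomial.coeff_sum, MvPolynomial.coeff_zero]
    by_cases hγ : ∀ j < p, γ j = 0
    · have := congrArg (MvPowerSeries.coeff γ) h0
      rw [Finsupp.linearCombination_apply, Finsupp.sum, map_sum, map_zero] at this
      rw [← this]
      refine Finset.sum_congr rfl fun u hu => ?_
      rw [MvPolynomial.coeff_smul, map_smul,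
        coeff_backStableSchubert (n := n) (hpq u hu) hγ (by omega)]
    · push Not at hγ
      obtain ⟨j, hj, hγj⟩ := hγ
      refine Finset.sum_eq_zero fun u _ => ?_
      rw [MvPolynomial.coeff_smul, coeff_schubertFamily_eq_zero hj n hγj, smul_zero]
  have hwc : w ∈ c.support := Finsupp.mem_support_iff.2 hw
  obtain ⟨φ, hφ⟩ := exists_dual_schubertFamily (n := n) ((hpq w hwc).mono le_rfl (by omega))
  classical
  have := congrArg φ hsum
  simp only [map_sum, map_smul, hφ, map_zero, smul_eq_mul, mul_ite, mul_one, mul_zero,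
    Finset.sum_ite_eq', hwc, if_true] at this
  exact hw this

/-! ### The operator `∇` on back stable Schubert polynomials -/

/-- The span defining `nabla` is the graph of a function. -/
theorem nabla_single_valued (x : MvPowerSeries ℤ ℚ × MvPowerSeries ℤ ℚ)
    (hx : x ∈ Submodule.span ℚ {p : MvPowerSeries ℤ ℚ × MvPowerSeries ℤ ℚ |
      ∃ u : Equiv.Perm ℤ, IsFinitary u ∧ p = (backStableSchubert u, nablaValue u)})
    (h0 : x.1 = 0) : x.2 = 0 := by
  have hset : {p : MvPowerSeries ℤ ℚ × MvPowerSeries ℤ ℚ |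
      ∃ u : Equiv.Perm ℤ, IsFinitary u ∧ p = (backStableSchubert u, nablaValue u)}
      = (fun u => (backStableSchubert u, nablaValue u)) '' {u | IsFinitary u} := by
    ext p
    simp only [Set.mem_ofPred_eq, Set.mem_image, eq_comm]
  rw [hset, Finsupp.mem_span_image_iff_linearCombination] at hx
  obtain ⟨c, hc, rfl⟩ := hx
  have h1 : Finsupp.linearCombination ℚ backStableSchubert c = 0 := by
    rw [← h0, Finsupp.linearCombination_apply, Finsupp.linearCombination_apply, Finsupp.sum,
      Finsupp.sum, Prod.fst_sum]
    rfl
  rw [linearIndepOn_iff.1 linearIndepOn_backStableSchubert c hc h1, map_zero, Prod.snd_zero]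

theorem nabla_backStableSchubert {u : Equiv.Perm ℤ} (hu : IsFinitary u) :
    ∃ h : backStableSchubert u ∈ nabla.domain,
      nabla ⟨backStableSchubert u, h⟩ = nablaValue u := by
  have hmem : (backStableSchubert u, nablaValue u) ∈ nabla.graph := by
    rw [nabla, Submodule.toLinearPMap_graph_eq _ nabla_single_valued]
    exact Submodule.subset_span ⟨u, hu, rfl⟩
  obtain ⟨y, hy1, hy2⟩ := (LinearPMap.mem_graph_iff nabla).1 hmem
  obtain ⟨y, hy⟩ := y
  dsimp only at hy1 hy2
  subst hy1
  exact ⟨hy, hy2⟩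

/-! ### Removable boxes -/

theorem mem_removableBoxes_iff {lam : YoungDiagram} {c : ℕ × ℕ} :
    c ∈ removableBoxes lam ↔ c ∈ lam ∧ (c.1 + 1, c.2) ∉ lam ∧ (c.1, c.2 + 1) ∉ lam := by
  classical
  rw [removableBoxes, Finset.mem_filter, YoungDiagram.mem_cells]
  refine and_congr_right fun hc => ⟨fun h => ?_, fun h => ?_⟩
  · have key : ∀ x : ℕ × ℕ, c ≤ x → x ≠ c → x ∉ lam := fun x hx hne hmem => by
      have h1 : x ∈ ((lam.cells.erase c : Finset (ℕ × ℕ)) : Set (ℕ × ℕ)) :=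
        Finset.mem_coe.2 (Finset.mem_erase.2 ⟨hne, hmem⟩)
      simpa using h hx (by convert h1)
    exact ⟨key _ ⟨by simp, le_rfl⟩ (fun h => by simpa using congrArg Prod.fst h),
      key _ ⟨le_rfl, by simp⟩ (fun h => by simpa using congrArg Prod.snd h)⟩
  · intro x y hyx hx
    have hx' : x ≠ c ∧ x ∈ lam := by
      have := Finset.mem_coe.1 hx
      rwa [Finset.mem_erase, YoungDiagram.mem_cells] at this
    have hy : y ≠ c := by
      rintro rfl
      rcases lt_or_eq_of_le hyx.1 with h1 | h1
      · exact h.1 (lam.up_left_mem (Nat.succ_le_of_lt h1) hyx.2 hx'.2)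
      · rcases lt_or_eq_of_le hyx.2 with h2 | h2
        · exact h.2 (lam.up_left_mem hyx.1 (Nat.succ_le_of_lt h2) hx'.2)
        · exact hx'.1 (Prod.ext h1.symm h2.symm)
    exact Finset.mem_coe.2 (Finset.mem_erase.2 ⟨hy, lam.isLowerSet hyx hx'.2⟩)

theorem mem_removeBox {lam : YoungDiagram} (c : {c : ℕ × ℕ // c ∈ removableBoxes lam})
    {x : ℕ × ℕ} : x ∈ removeBox lam c ↔ x ≠ c.1 ∧ x ∈ lam := by
  rw [← YoungDiagram.mem_cells, removeBox, Finset.mem_erase, YoungDiagram.mem_cells]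

theorem removableBoxes_mem {lam : YoungDiagram} (c : {c : ℕ × ℕ // c ∈ removableBoxes lam}) :
    c.1 ∈ lam := (mem_removableBoxes_iff.1 c.2).1

theorem rowLen_of_removable {lam : YoungDiagram} (c : {c : ℕ × ℕ // c ∈ removableBoxes lam}) :
    lam.rowLen c.1.1 = c.1.2 + 1 := by
  obtain ⟨h1, -, h3⟩ := mem_removableBoxes_iff.1 c.2
  have h1' : c.1.2 < lam.rowLen c.1.1 := YoungDiagram.mem_iff_lt_rowLen.1 h1
  rw [YoungDiagram.mem_iff_lt_rowLen] at h3
  omega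

theorem colLen_of_removable {lam : YoungDiagram} (c : {c : ℕ × ℕ // c ∈ removableBoxes lam}) :
    lam.colLen c.1.2 = c.1.1 + 1 := by
  obtain ⟨h1, h2, -⟩ := mem_removableBoxes_iff.1 c.2
  have h1' : c.1.1 < lam.colLen c.1.2 := YoungDiagram.mem_iff_lt_colLen.1 h1
  rw [YoungDiagram.mem_iff_lt_colLen] at h2
  omega

theorem rowLen_removeBox {lam : YoungDiagram} (c : {c : ℕ × ℕ // c ∈ removableBoxes lam}) (i : ℕ) :
    (removeBox lam c).rowLen i = if i = c.1.1 then c.1.2 else lam.rowLen i := by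
  have hr := rowLen_of_removable c
  obtain ⟨⟨a, b⟩, hc⟩ := c
  dsimp only at hr ⊢
  refine eq_of_forall_lt_iff fun j => ?_
  rw [← YoungDiagram.mem_iff_lt_rowLen, mem_removeBox, YoungDiagram.mem_iff_lt_rowLen, Ne,
    Prod.ext_iff]
  split_ifs with h
  · subst h
    simp only [true_and]
    omega
  · simp [h]

theorem colLen_removeBox {lam : YoungDiagram} (c : {c : ℕ × ℕ // c ∈ removableBoxes lam}) (j : ℕ) :
    (removeBox lam c).colLen j = if j = c.1.2 then c.1.1 else lam.colLen j := by
  have hr := colLen_of_removable c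
  obtain ⟨⟨a, b⟩, hc⟩ := c
  dsimp only at hr ⊢
  refine eq_of_forall_lt_iff fun i => ?_
  rw [← YoungDiagram.mem_iff_lt_colLen, mem_removeBox, YoungDiagram.mem_iff_lt_colLen, Ne,
    Prod.ext_iff]
  split_ifs with h
  · subst h
    simp only [and_true]
    omega
  · simp [h]

/-- A box on the diagonal of a removable box `c`, other than `c`, lies strictly above and to the
left of `c`. -/
theorem eq_of_content_eq {lam : YoungDiagram} {c x : ℕ × ℕ} (hc : c ∈ removableBoxes lam)
    (hx : x ∈ lam) (h : content x = content c) : x = c ∨ x.1 < c.1 ∧ x.2 < c.2 := by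
  obtain ⟨h1, h2, h3⟩ := mem_removableBoxes_iff.1 hc
  simp only [content] at h
  rcases lt_trichotomy x.1 c.1 with h4 | h4 | h4
  · exact Or.inr ⟨h4, by omega⟩
  · exact Or.inl (Prod.ext h4 (by omega))
  · exact absurd (lam.up_left_mem (Nat.succ_le_of_lt h4) (by omega : c.2 ≤ x.2) hx) h2

theorem content_injective (lam : YoungDiagram) :
    Function.Injective fun c : {c : ℕ × ℕ // c ∈ removableBoxes lam} => content c.1 := by
  intro c d h
  have h1 := eq_of_content_eq d.2 (removableBoxes_mem c) h
  have h2 := eq_of_content_eq c.2 (removableBoxes_mem d) h.symm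
  apply Subtype.ext
  rcases h1 with h1 | h1
  · exact h1
  · rcases h2 with h2 | h2
    · exact h2.symm
    · omega

/-! ### Grassmannian permutations -/

/-- The Grassmannian permutation of shape `lam` with descent at `k`, as a function. -/
def grassmannianFun (lam : YoungDiagram) (k x : ℤ) : ℤ :=
  if x ≤ k then x + lam.rowLen (k - x).toNat else x - lam.colLen (x - k - 1).toNat

theorem rowLen_add_colLen_ne (lam : YoungDiagram) (i j : ℕ) :
    lam.rowLen i + lam.colLen j ≠ i + j + 1 := by
  by_cases h : (i, j) ∈ lam
  · have h1 := YoungDiagram.mem_iff_lt_rowLen.1 h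
    have h2 := YoungDiagram.mem_iff_lt_colLen.1 h
    omega
  · have h1 := mt YoungDiagram.mem_iff_lt_rowLen.2 h
    have h2 := mt YoungDiagram.mem_iff_lt_colLen.2 h
    omega

theorem grassmannianFun_injective (lam : YoungDiagram) (k : ℤ) :
    Function.Injective (grassmannianFun lam k) := by
  have key : ∀ x y : ℤ, x < y → grassmannianFun lam k x ≠ grassmannianFun lam k y := by
    intro x y hxy
    simp only [grassmannianFun]
    split_ifs with h1 h2 h2
    · have := lam.rowLen_anti (k - y).toNat (k - x).toNat (by omega)
      omega
    · have := rowLen_add_colLen_ne lam (k - x).toNat (y - k - 1).toNat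
      omega
    · omega
    · have := lam.colLen_anti (x - k - 1).toNat (y - k - 1).toNat (by omega)
      omega
  intro x y h
  rcases lt_trichotomy x y with h1 | h1 | h1
  · exact absurd h (key x y h1)
  · exact h1
  · exact absurd h.symm (key y x h1)

theorem grassmannianFun_eq_self {lam : YoungDiagram} {k x : ℤ}
    (hx : ¬ (k + 1 - lam.colLen 0 ≤ x ∧ x ≤ k + lam.rowLen 0)) : grassmannianFun lam k x = x := by
  have hr : ∀ i : ℕ, lam.colLen 0 ≤ i → lam.rowLen i = 0 := fun i hi => by
    have := mt YoungDiagram.mem_iff_lt_colLen.1 (not_lt.2 hi)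
    rw [YoungDiagram.mem_iff_lt_rowLen] at this
    omega
  have hc : ∀ j : ℕ, lam.rowLen 0 ≤ j → lam.colLen j = 0 := fun j hj => by
    have := mt YoungDiagram.mem_iff_lt_rowLen.1 (not_lt.2 hj)
    rw [YoungDiagram.mem_iff_lt_colLen] at this
    omega
  simp only [grassmannianFun]
  split_ifs with h
  · rw [hr _ (by omega)]; simp
  · rw [hc _ (by omega)]; simp

theorem grassmannianFun_surjective (lam : YoungDiagram) (k : ℤ) :
    Function.Surjective (grassmannianFun lam k) := by
  intro y
  by_cases hy : k + 1 - lam.colLen 0 ≤ y ∧ y ≤ k + lam.rowLen 0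
  · have hmaps : Set.MapsTo (grassmannianFun lam k)
        (Set.Icc (k + 1 - lam.colLen 0) (k + lam.rowLen 0))
        (Set.Icc (k + 1 - lam.colLen 0) (k + lam.rowLen 0)) := by
      rintro x ⟨h1, h2⟩
      have := lam.rowLen_anti 0 (k - x).toNat (by omega)
      have := lam.colLen_anti 0 (x - k - 1).toNat (by omega)
      simp only [grassmannianFun, Set.mem_Icc]
      split_ifs <;> omega
    obtain ⟨x, -, hx⟩ := (((Set.finite_Icc _ _).injOn_iff_bijOn_of_mapsTo hmaps).1
      (grassmannianFun_injective lam k).injOn).surjOn hy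
    exact ⟨x, hx⟩
  · exact ⟨y, grassmannianFun_eq_self hy⟩

/-- The Grassmannian permutation of shape `lam` with descent at `k`: it maps `k - i` to
`k - i + rowLen i` and `k + 1 + j` to `k + 1 + j - colLen j`, for `i, j ≥ 0`. -/
def grassmannian (lam : YoungDiagram) (k : ℤ) : Equiv.Perm ℤ :=
  Equiv.ofBijective (grassmannianFun lam k)
    ⟨grassmannianFun_injective lam k, grassmannianFun_surjective lam k⟩

theorem grassmannian_apply (lam : YoungDiagram) (k x : ℤ) :
    grassmannian lam k x
      = if x ≤ k then x + lam.rowLen (k - x).toNat else x - lam.colLen (x - k - 1).toNat := rfl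

theorem grassmannian_sub (lam : YoungDiagram) (k : ℤ) (i : ℕ) :
    grassmannian lam k (k - i) = k - i + lam.rowLen i := by
  rw [grassmannian_apply, if_pos (by omega), sub_sub_cancel, Int.toNat_natCast]

theorem grassmannian_add (lam : YoungDiagram) (k : ℤ) (j : ℕ) :
    grassmannian lam k (k + 1 + j) = k + 1 + j - lam.colLen j := by
  rw [grassmannian_apply, if_neg (by omega), show k + 1 + (j : ℤ) - k - 1 = j by ring,
    Int.toNat_natCast]

theorem fixesOutside_grassmannian (lam : YoungDiagram) (k : ℤ) :
    FixesOutside (k + 1 - lam.colLen 0) (k + lam.rowLen 0) (grassmannian lam k) :=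
  fun _ hx => grassmannianFun_eq_self hx

theorem grassmannian_inv_removable {lam : YoungDiagram} (k : ℤ)
    (c : {c : ℕ × ℕ // c ∈ removableBoxes lam}) :
    (grassmannian lam k)⁻¹ (k + content c.1) = k + 1 + c.1.2 ∧
      (grassmannian lam k)⁻¹ (k + content c.1 + 1) = k - c.1.1 := by
  constructor <;> rw [Equiv.Perm.inv_eq_iff_eq]
  · rw [grassmannian_add, colLen_of_removable, content]
    push_cast
    ring
  · rw [grassmannian_sub, rowLen_of_removable, content]
    push_cast
    ring

/-- The left descents of a Grassmannian permutation correspond to the removable boxes. -/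
theorem grassmannian_descent_iff (lam : YoungDiagram) (k m : ℤ) :
    (grassmannian lam k)⁻¹ (m + 1) < (grassmannian lam k)⁻¹ m ↔
      ∃ c : {c : ℕ × ℕ // c ∈ removableBoxes lam}, k + content c.1 = m := by
  constructor
  · intro h
    obtain ⟨x, hx⟩ : ∃ x, (grassmannian lam k)⁻¹ (m + 1) = x := ⟨_, rfl⟩
    obtain ⟨y, hy⟩ : ∃ y, (grassmannian lam k)⁻¹ m = y := ⟨_, rfl⟩
    rw [hx, hy] at h
    rw [Equiv.Perm.inv_eq_iff_eq] at hx hy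
    rw [grassmannian_apply] at hx hy
    split_ifs at hx hy with h1 h2 h2
    · have := lam.rowLen_anti (k - y).toNat (k - x).toNat (by omega)
      omega
    · obtain ⟨i, rfl⟩ : ∃ i : ℕ, x = k - i := ⟨(k - x).toNat, by omega⟩
      obtain ⟨j, rfl⟩ : ∃ j : ℕ, y = k + 1 + j := ⟨(y - k - 1).toNat, by omega⟩
      rw [sub_sub_cancel, Int.toNat_natCast] at hx
      rw [show k + 1 + (j : ℤ) - k - 1 = j by ring, Int.toNat_natCast] at hy
      have hmem : (i, j) ∈ lam := by
        by_contra hc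
        have h3 := mt YoungDiagram.mem_iff_lt_rowLen.2 hc
        have h4 := mt YoungDiagram.mem_iff_lt_colLen.2 hc
        omega
      have h3 := YoungDiagram.mem_iff_lt_rowLen.1 hmem
      have h4 := YoungDiagram.mem_iff_lt_colLen.1 hmem
      have hrem : (i, j) ∈ removableBoxes lam := by
        refine mem_removableBoxes_iff.2 ⟨hmem, fun h => ?_, fun h => ?_⟩
        · have := YoungDiagram.mem_iff_lt_colLen.1 h
          dsimp only at this
          omega
        · have := YoungDiagram.mem_iff_lt_rowLen.1 h
          dsimp only at this
          omega
      refine ⟨⟨(i, j), hrem⟩, ?_⟩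
      simp only [content]
      omega
    · omega
    · have := lam.colLen_anti (x - k - 1).toNat (y - k - 1).toNat (by omega)
      omega
  · rintro ⟨c, rfl⟩
    obtain ⟨h1, h2⟩ := grassmannian_inv_removable k c
    rw [h1, h2]
    omega

/-- Removing a box of content `m - k` is multiplication by `s_m` on the left. -/
theorem simpleTransposition_mul_grassmannian {lam : YoungDiagram} (k : ℤ)
    (c : {c : ℕ × ℕ // c ∈ removableBoxes lam}) :
    simpleTransposition (k + content c.1) * grassmannian lam k
      = grassmannian (removeBox lam c) k := by
  obtain ⟨h1, h2⟩ := grassmannian_inv_removable k c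
  have hrow := rowLen_of_removable c
  have hcol := colLen_of_removable c
  have hx : ∀ x, grassmannian lam k x = k + content c.1 ↔ x = k + 1 + c.1.2 := fun x => by
    rw [← h1, Equiv.Perm.eq_inv_iff_eq]
  have hx' : ∀ x, grassmannian lam k x = k + content c.1 + 1 ↔ x = k - c.1.1 := fun x => by
    rw [← h2, Equiv.Perm.eq_inv_iff_eq]
  ext x
  rw [Equiv.Perm.mul_apply, simpleTransposition_apply]
  simp only [hx, hx']
  rw [grassmannian_apply, grassmannian_apply, rowLen_removeBox, colLen_removeBox]
  simp only [content]
  split_ifs <;> omega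

/-! ### Tableaux and their weights -/

/-- The exponent vector of the monomial of a tableau, an entry `n` contributing `x_{k-n}`. -/
def weight {lam : YoungDiagram} (k : ℤ) (T : SemistandardYoungTableau lam) : ℤ →₀ ℕ :=
  ∑ c ∈ lam.cells, Finsupp.single (k - (T c.1 c.2 : ℤ)) 1

theorem weight_apply {lam : YoungDiagram} (k : ℤ) (T : SemistandardYoungTableau lam) (y : ℤ) :
    weight k T y = (lam.cells.filter fun c => k - (T c.1 c.2 : ℤ) = y).card := by
  rw [weight, Finsupp.finsetSum_apply, Finset.card_filter]
  exact Finset.sum_congr rfl fun c _ => Finsupp.single_apply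

theorem weight_apply_ne_zero {lam : YoungDiagram} (k : ℤ) (T : SemistandardYoungTableau lam)
    {c : ℕ × ℕ} (hc : c ∈ lam) : weight k T (k - (T c.1 c.2 : ℤ)) ≠ 0 := by
  rw [weight_apply]
  exact Finset.card_ne_zero_of_mem (Finset.mem_filter.2 ⟨hc, rfl⟩)

theorem finite_weight_eq (lam : YoungDiagram) (k : ℤ) (γ : ℤ →₀ ℕ) :
    {T : SemistandardYoungTableau lam | weight k T = γ}.Finite := by
  have hinj : Function.Injective fun (T : SemistandardYoungTableau lam) (c : lam.cells) =>
      T c.1.1 c.1.2 := by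
    intro T T' h
    ext i j
    by_cases hij : (i, j) ∈ lam
    · exact congrFun h ⟨(i, j), hij⟩
    · rw [T.zeros hij, T'.zeros hij]
  have hfin : (Set.univ.pi fun _ : lam.cells =>
      ((γ.support.image fun y => (k - y).toNat : Finset ℕ) : Set ℕ)).Finite :=
    Set.Finite.pi fun _ => Finset.finite_toSet _
  refine (hfin.preimage hinj.injOn).subset ?_
  intro T hT c _
  have hT' : weight k T = γ := hT
  refine Finset.mem_coe.2 (Finset.mem_image.2 ⟨k - (T c.1.1 c.1.2 : ℤ), ?_, by simp⟩)
  rw [Finsupp.mem_support_iff, ← hT']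
  exact weight_apply_ne_zero k T c.2

theorem schur_apply (lam : YoungDiagram) (k : ℤ) (γ : ℤ →₀ ℕ) :
    MvPowerSeries.coeff γ (schur lam k)
      = ({T : SemistandardYoungTableau lam | weight k T = γ}.ncard : ℚ) := by
  rw [← Nat.card_coe_set_eq]
  rfl

/-! ### Removing and adding a box of a tableau -/

/-- The restriction of a tableau to the diagram without the box `c`. -/
def removeEntry {lam : YoungDiagram} (c : {c : ℕ × ℕ // c ∈ removableBoxes lam})
    (T : SemistandardYoungTableau lam) : SemistandardYoungTableau (removeBox lam c) where
  entry i j := if (i, j) = c.1 then 0 else T i j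
  row_weak' {i j1 j2} hj hmem := by
    rw [mem_removeBox] at hmem
    rw [if_neg hmem.1]
    split_ifs
    · exact Nat.zero_le _
    · exact T.row_weak hj hmem.2
  col_strict' {i1 i2 j} hi hmem := by
    rw [mem_removeBox] at hmem
    rw [if_neg hmem.1]
    split_ifs
    · exact (Nat.zero_le _).trans_lt (T.col_strict hi hmem.2)
    · exact T.col_strict hi hmem.2
  zeros' {i j} hmem := by
    rw [mem_removeBox] at hmem
    split_ifs with h
    · rfl
    · exact T.zeros fun h' => hmem ⟨h, h'⟩

theorem removeEntry_apply {lam : YoungDiagram} (c : {c : ℕ × ℕ // c ∈ removableBoxes lam})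
    (T : SemistandardYoungTableau lam) (i j : ℕ) :
    removeEntry c T i j = if (i, j) = c.1 then 0 else T i j := rfl

/-- The extension of a tableau by an entry `m` in the box `c`. -/
def addEntry {lam : YoungDiagram} (c : {c : ℕ × ℕ // c ∈ removableBoxes lam}) (m : ℕ)
    (T : SemistandardYoungTableau (removeBox lam c)) (hrow : ∀ j < c.1.2, T c.1.1 j ≤ m)
    (hcol : ∀ i < c.1.1, T i c.1.2 < m) : SemistandardYoungTableau lam where
  entry i j := if (i, j) = c.1 then m else T i j
  row_weak' {i j1 j2} hj hmem := by
    obtain ⟨h1, h2, h3⟩ := mem_removableBoxes_iff.1 c.2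
    by_cases h : (i, j1) = c.1
    · have e1 : i = c.1.1 := congrArg Prod.fst h
      have e2 : j1 = c.1.2 := congrArg Prod.snd h
      exact absurd (lam.up_left_mem e1.ge (by omega) hmem) h3
    · rw [if_neg h]
      split_ifs with h'
      · have := hrow j1 (by rw [← h']; exact hj)
        rwa [← h'] at this
      · exact T.row_weak hj ((mem_removeBox c).2 ⟨h', hmem⟩)
  col_strict' {i1 i2 j} hi hmem := by
    obtain ⟨h1, h2, h3⟩ := mem_removableBoxes_iff.1 c.2
    by_cases h : (i1, j) = c.1
    · have e1 : i1 = c.1.1 := congrArg Prod.fst h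
      have e2 : j = c.1.2 := congrArg Prod.snd h
      exact absurd (lam.up_left_mem (by omega) e2.ge hmem) h2
    · rw [if_neg h]
      split_ifs with h'
      · have := hcol i1 (by rw [← h']; exact hi)
        rwa [← h'] at this
      · exact T.col_strict hi ((mem_removeBox c).2 ⟨h', hmem⟩)
  zeros' {i j} hmem := by
    rw [if_neg]
    · exact T.zeros fun h => hmem ((mem_removeBox c).1 h).2
    · intro h
      exact hmem (h ▸ removableBoxes_mem c)

theorem addEntry_apply {lam : YoungDiagram} (c : {c : ℕ × ℕ // c ∈ removableBoxes lam}) (m : ℕ)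
    (T : SemistandardYoungTableau (removeBox lam c)) (hrow : ∀ j < c.1.2, T c.1.1 j ≤ m)
    (hcol : ∀ i < c.1.1, T i c.1.2 < m) (i j : ℕ) :
    addEntry c m T hrow hcol i j = if (i, j) = c.1 then m else T i j := rfl

theorem removeEntry_addEntry {lam : YoungDiagram} (c : {c : ℕ × ℕ // c ∈ removableBoxes lam})
    (m : ℕ) (T : SemistandardYoungTableau (removeBox lam c)) (hrow : ∀ j < c.1.2, T c.1.1 j ≤ m)
    (hcol : ∀ i < c.1.1, T i c.1.2 < m) : removeEntry c (addEntry c m T hrow hcol) = T := by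
  ext i j
  rw [removeEntry_apply, addEntry_apply]
  split_ifs with h
  · exact (T.zeros fun h' => ((mem_removeBox c).1 h').1 h).symm
  · rfl

theorem weight_removeEntry {lam : YoungDiagram} (k : ℤ)
    (c : {c : ℕ × ℕ // c ∈ removableBoxes lam}) (T : SemistandardYoungTableau lam) :
    weight k T = weight k (removeEntry c T) + Finsupp.single (k - (T c.1.1 c.1.2 : ℤ)) 1 := by
  rw [weight, ← Finset.sum_erase_add _ _ (removableBoxes_mem c), weight]
  congr 1
  refine Finset.sum_congr rfl fun x hx => ?_
  rw [removeEntry_apply, if_neg]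
  exact fun h => (Finset.mem_erase.1 hx).1 h

theorem weight_addEntry {lam : YoungDiagram} (k : ℤ)
    (c : {c : ℕ × ℕ // c ∈ removableBoxes lam}) (m : ℕ)
    (T : SemistandardYoungTableau (removeBox lam c)) (hrow : ∀ j < c.1.2, T c.1.1 j ≤ m)
    (hcol : ∀ i < c.1.1, T i c.1.2 < m) :
    weight k (addEntry c m T hrow hcol) = weight k T + Finsupp.single (k - (m : ℤ)) 1 := by
  rw [weight_removeEntry k c, removeEntry_addEntry, addEntry_apply, if_pos rfl]

/-! ### Schur functions as back stable Schubert polynomials -/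

/-- The tableaux of weight `γ` with entries at most `M`, in which the entry `M` occurs only in boxes
of content less than `n - M`. -/
def partialTableaux (lam : YoungDiagram) (k : ℤ) (M n : ℕ) (γ : ℤ →₀ ℕ) :
    Set (SemistandardYoungTableau lam) :=
  {T | weight k T = γ ∧ (∀ x ∈ lam, T x.1 x.2 ≤ M) ∧
    ∀ x ∈ lam, T x.1 x.2 = M → content x + M < n}

theorem finite_partialTableaux (lam : YoungDiagram) (k : ℤ) (M n : ℕ) (γ : ℤ →₀ ℕ) :
    (partialTableaux lam k M n γ).Finite :=
  (finite_weight_eq lam k γ).subset fun _ hT => hT.1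

/-- Without a removable box of content `n - M`, the boxes of this content cannot contain `M`. -/
theorem partialTableaux_succ_of_forall_ne {lam : YoungDiagram} {k : ℤ} {M n : ℕ} {γ : ℤ →₀ ℕ}
    (h : ∀ c : {c : ℕ × ℕ // c ∈ removableBoxes lam}, content c.1 + M ≠ n) :
    partialTableaux lam k M (n + 1) γ = partialTableaux lam k M n γ := by
  ext T
  refine and_congr_right fun _ => and_congr_right fun hle => ⟨fun hT x hx hxM => ?_,
    fun hT x hx hxM => by have := hT x hx hxM; push_cast; omega⟩
  have h1 := hT x hx hxM
  push_cast at h1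
  -- A box of the largest admissible content with the largest entry has neither a right nor a lower
  -- neighbour.
  have hne : content x + M ≠ n := by
    intro heq
    refine h ⟨x, mem_removableBoxes_iff.2 ⟨hx, fun hx' => ?_, fun hx' => ?_⟩⟩ heq
    · have := T.col_strict (Nat.lt_add_one x.1) hx'
      have := hle _ hx'
      dsimp only at this
      omega
    · have := T.row_weak (Nat.lt_add_one x.2) hx'
      have h2 := hle _ hx'
      have h3 := hT _ hx' (by dsimp only at h2 ⊢; omega)
      simp only [content] at h3 heq
      push_cast at h3
      omega
  omega

/-- With a removable box `c` of content `n - M`, the tableaux in which `M` is admitted in the boxes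
of this content are split according to whether `c` contains `M`; if it does, the box is removed. -/
theorem ncard_partialTableaux_succ {lam : YoungDiagram} {k : ℤ} {M n : ℕ} {γ : ℤ →₀ ℕ}
    (c : {c : ℕ × ℕ // c ∈ removableBoxes lam}) (hc : content c.1 + M = n) :
    (partialTableaux lam k M (n + 1) γ).ncard = (partialTableaux lam k M n γ).ncard +
      if γ (k - M) ≠ 0 then
        (partialTableaux (removeBox lam c) k M n (γ - Finsupp.single (k - (M : ℤ)) 1)).ncard
      else 0 := by
  -- Other boxes on the diagonal of `c` have smaller entries.
  have hdiag : ∀ (T : SemistandardYoungTableau lam) (x : ℕ × ℕ), x ∈ lam → x ≠ c.1 →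
      content x = content c.1 → T x.1 x.2 < T c.1.1 c.1.2 := by
    intro T x hx hne hcont
    rcases eq_of_content_eq c.2 hx hcont with h | ⟨h1, h2⟩
    · exact absurd h hne
    · have hcmem := removableBoxes_mem c
      have h3 : (x.1, c.1.2) ∈ lam := lam.up_left_mem h1.le le_rfl hcmem
      exact (T.row_weak h2 h3).trans_lt (T.col_strict h1 hcmem)
  have hsplit : partialTableaux lam k M (n + 1) γ = partialTableaux lam k M n γ ∪
      {T ∈ partialTableaux lam k M (n + 1) γ | T c.1.1 c.1.2 = M} := by
    ext T
    constructor
    · intro hT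
      by_cases h : T c.1.1 c.1.2 = M
      · exact Or.inr ⟨hT, h⟩
      · refine Or.inl ⟨hT.1, hT.2.1, fun x hx hxM => ?_⟩
        have h1 := hT.2.2 x hx hxM
        push_cast at h1
        have hne : content x ≠ content c.1 := by
          intro heq
          have h2 : x ≠ c.1 := fun h' => h (h' ▸ hxM)
          have := hdiag T x hx h2 heq
          have := hT.2.1 c.1 (removableBoxes_mem c)
          omega
        omega
    · rintro (hT | hT)
      · exact ⟨hT.1, hT.2.1, fun x hx hxM => by
          have := hT.2.2 x hx hxM; push_cast; omega⟩
      · exact hT.1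
  have hdisj : Disjoint (partialTableaux lam k M n γ)
      {T ∈ partialTableaux lam k M (n + 1) γ | T c.1.1 c.1.2 = M} := by
    rw [Set.disjoint_left]
    rintro T hT ⟨-, hTc⟩
    have := hT.2.2 c.1 (removableBoxes_mem c) hTc
    omega
  rw [hsplit, Set.ncard_union_eq hdisj (finite_partialTableaux lam k M n γ)
    ((finite_partialTableaux lam k M (n + 1) γ).subset fun _ hT => hT.1)]
  congr 1
  split_ifs with hγ
  · have hγ' : γ - Finsupp.single (k - (M : ℤ)) 1 + Finsupp.single (k - (M : ℤ)) 1 = γ :=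
      tsub_add_cancel_of_le
        (Finsupp.single_le_iff.2 (Nat.one_le_iff_ne_zero.2 hγ))
    refine Set.ncard_congr (fun T _ => removeEntry c T) ?_ ?_ ?_
    · rintro T ⟨hT, hTc⟩
      refine ⟨?_, fun x hx => ?_, fun x hx hxM => ?_⟩
      · have := weight_removeEntry k c T
        rw [hT.1, hTc] at this
        rw [this, add_tsub_cancel_right]
      · rw [mem_removeBox] at hx
        rw [removeEntry_apply, if_neg hx.1]
        exact hT.2.1 x hx.2
      · rw [mem_removeBox] at hx
        rw [removeEntry_apply, if_neg hx.1] at hxM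
        have h1 := hT.2.2 x hx.2 hxM
        push_cast at h1
        have hne : content x ≠ content c.1 := by
          intro heq
          have := hdiag T x hx.2 hx.1 heq
          omega
        omega
    · rintro T T' ⟨-, hT⟩ ⟨-, hT'⟩ h
      ext i j
      by_cases hij : (i, j) = c.1
      · obtain ⟨rfl, rfl⟩ := Prod.ext_iff.1 hij
        exact hT.trans hT'.symm
      · have := congrArg (fun S : SemistandardYoungTableau (removeBox lam c) => S i j) h
        simpa [removeEntry_apply, hij] using this
    · intro T hT
      have hmem : ∀ x ∈ lam, x ≠ c.1 → x ∈ removeBox lam c := fun x hx hne =>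
        (mem_removeBox c).2 ⟨hne, hx⟩
      have hcmem := removableBoxes_mem c
      have hrow : ∀ j < c.1.2, T c.1.1 j ≤ M := fun j hj =>
        hT.2.1 (c.1.1, j) (hmem _ (lam.up_left_mem le_rfl hj.le hcmem) fun h => by
          have := congrArg Prod.snd h
          dsimp only at this
          omega)
      have hcol : ∀ i < c.1.1, T i c.1.2 < M := fun i hi => by
        have h1 : (i, c.1.2) ∈ removeBox lam c :=
          hmem _ (lam.up_left_mem hi.le le_rfl hcmem) fun h => by
            have := congrArg Prod.fst h
            dsimp only at this
            omega
        refine lt_of_le_of_ne (hT.2.1 _ h1) fun h => ?_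
        have := hT.2.2 _ h1 h
        simp only [content] at this hc
        omega
      refine ⟨addEntry c M T hrow hcol, ⟨⟨?_, fun x hx => ?_, fun x hx hxM => ?_⟩, ?_⟩,
        removeEntry_addEntry c M T hrow hcol⟩
      · rw [weight_addEntry, hT.1, hγ']
      · rw [addEntry_apply]
        split_ifs with h
        · exact le_rfl
        · exact hT.2.1 x (hmem x hx h)
      · rw [addEntry_apply] at hxM
        push_cast
        split_ifs at hxM with h
        · have h' : x = c.1 := h
          rw [h']
          omega
        · have := hT.2.2 x (hmem x hx h) hxM
          omega
      · rw [addEntry_apply, if_pos rfl]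
  · rw [Set.ncard_eq_zero ((finite_partialTableaux lam k M (n + 1) γ).subset fun _ hT => hT.1),
      Set.eq_empty_iff_forall_notMem]
    rintro T ⟨hT, hTc⟩
    have := weight_apply_ne_zero k T (removableBoxes_mem c)
    rw [hTc, hT.1] at this
    exact hγ this

/-- The tableaux of weight `γ` with entries less than `M`. -/
def boundedTableaux (lam : YoungDiagram) (k : ℤ) (M : ℕ) (γ : ℤ →₀ ℕ) :
    Set (SemistandardYoungTableau lam) :=
  {T | weight k T = γ ∧ ∀ x ∈ lam, T x.1 x.2 < M}

theorem row_le_apply {lam : YoungDiagram} {T : SemistandardYoungTableau lam} {i j : ℕ}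
    (h : (i, j) ∈ lam) : i ≤ T i j := by
  induction i with
  | zero => exact Nat.zero_le _
  | succ i ih =>
    have := ih (lam.up_left_mem i.le_succ le_rfl h)
    have := T.col_strict (Nat.lt_add_one i) h
    omega

theorem partialTableaux_zero (lam : YoungDiagram) (k : ℤ) (M : ℕ) (γ : ℤ →₀ ℕ) :
    partialTableaux lam k M 0 γ = boundedTableaux lam k M γ := by
  ext T
  refine and_congr_right fun _ => ⟨fun h x hx => ?_, fun h => ⟨fun x hx => (h x hx).le,
    fun x hx hxM => absurd hxM (h x hx).ne⟩⟩
  refine lt_of_le_of_ne (h.1 x hx) fun hxM => ?_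
  have h1 := h.2 x hx hxM
  have h2 : x.1 ≤ T x.1 x.2 := row_le_apply hx
  simp only [content] at h1
  omega

theorem partialTableaux_eq_boundedTableaux {lam : YoungDiagram} (k : ℤ) {M n : ℕ} (γ : ℤ →₀ ℕ)
    (h : lam.rowLen 0 + M ≤ n) :
    partialTableaux lam k M n γ = boundedTableaux lam k (M + 1) γ := by
  ext T
  refine and_congr_right fun _ => ⟨fun h x hx => Nat.lt_succ_of_le (h.1 x hx), fun h' =>
    ⟨fun x hx => Nat.le_of_lt_succ (h' x hx), fun x hx _ => ?_⟩⟩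
  have h1 : x.2 < lam.rowLen x.1 := YoungDiagram.mem_iff_lt_rowLen.1 hx
  have h2 := lam.rowLen_anti 0 x.1 (Nat.zero_le _)
  simp only [content]
  omega

theorem rowLen_removeBox_le {lam : YoungDiagram} (c : {c : ℕ × ℕ // c ∈ removableBoxes lam})
    (i : ℕ) : (removeBox lam c).rowLen i ≤ lam.rowLen i := by
  rw [rowLen_removeBox]
  split_ifs with h
  · rw [h, rowLen_of_removable]
    omega
  · exact le_rfl

/-- Multiplying by one more factor `1 + x u_j` allows the largest entry in the boxes of one more
content. -/
theorem coeff_fan_grassmannian {k : ℤ} {M m : ℕ} {g : PermFun}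
    (hg : ∀ (lam : YoungDiagram) (γ : ℤ →₀ ℕ), lam.rowLen 0 + M ≤ m →
      MvPolynomial.coeff γ (g (grassmannian lam k)) = (boundedTableaux lam k M γ).ncard)
    (n : ℕ) (lam : YoungDiagram) (γ : ℤ →₀ ℕ) (h : lam.rowLen 0 + M ≤ m) :
    MvPolynomial.coeff γ (fan (k - M) n (MvPolynomial.X (k - M)) g (grassmannian lam k))
      = (partialTableaux lam k M n γ).ncard := by
  induction n generalizing lam γ with
  | zero => rw [partialTableaux_zero]; exact hg lam γ h
  | succ n ih =>
    rw [fan, Module.End.mul_apply, nilFactor_apply, MvPolynomial.coeff_add, ih lam γ h,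
      leftNil_apply, MvPolynomial.coeff_X_mul']
    by_cases hex : ∃ c : {c : ℕ × ℕ // c ∈ removableBoxes lam}, content c.1 + M = n
    · obtain ⟨c, hc⟩ := hex
      have hj : k - M + (n : ℤ) = k + content c.1 := by omega
      rw [hj, if_pos ((grassmannian_descent_iff lam k _).2 ⟨c, rfl⟩),
        simpleTransposition_mul_grassmannian,
        ih _ _ ((Nat.add_le_add_right (rowLen_removeBox_le c 0) M).trans h),
        ncard_partialTableaux_succ c hc]
      by_cases hγ : γ (k - M) = 0
      · rw [if_neg (by simpa using hγ), if_neg (by simpa using hγ), add_zero, add_zero]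
      · rw [if_pos (by simpa using hγ), if_pos hγ, Nat.cast_add]
    · push Not at hex
      have hdesc :
          ¬ (grassmannian lam k)⁻¹ (k - M + n + 1) < (grassmannian lam k)⁻¹ (k - M + n) := by
        rw [grassmannian_descent_iff]
        rintro ⟨c, hc⟩
        exact hex c (by omega)
      rw [partialTableaux_succ_of_forall_ne hex, if_neg hdesc]
      simp

/-- The Schubert polynomial of a Grassmannian permutation in the variables from `x_{k+1-M}` on is
the Schur polynomial in `x_{k+1-M}, …, x_k`. Each further variable `x_{k-M}` contributes a fan,
which admits the entry `M`, and `rowLen 0 + M ≤ n` ensures that its indices reach all contents. -/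
theorem coeff_schubertFamily_grassmannian (k : ℤ) (M : ℕ) (lam : YoungDiagram) (n : ℕ)
    (γ : ℤ →₀ ℕ) (h : lam.rowLen 0 + M ≤ n) :
    MvPolynomial.coeff γ (schubertFamily (k + 1 - M) n (grassmannian lam k))
      = (boundedTableaux lam k M γ).ncard := by
  induction M generalizing lam n γ with
  | zero =>
    rw [Nat.cast_zero, sub_zero]
    by_cases hlam : (0, 0) ∈ lam
    · have hempty : boundedTableaux lam k 0 γ = ∅ :=
        Set.eq_empty_iff_forall_notMem.2 fun T hT => absurd (hT.2 _ hlam) (Nat.not_lt_zero _)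
      rw [hempty, Set.ncard_empty, schubertFamily_eq_zero (lt_add_one k)]
      · simp
      · have h1 := grassmannian_sub lam k 0
        have h2 := YoungDiagram.mem_iff_lt_rowLen.1 hlam
        rw [Nat.cast_zero, sub_zero] at h1
        omega
    · have hmem : ∀ x, x ∉ lam := fun x hx =>
        hlam (lam.up_left_mem (Nat.zero_le x.1) (Nat.zero_le x.2) hx)
      have hcells : lam.cells = ∅ :=
        Finset.eq_empty_of_forall_notMem fun x hx => hmem x hx
      have hone : grassmannian lam k = 1 := by
        have h1 := mt YoungDiagram.mem_iff_lt_rowLen.2 hlam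
        have h2 := mt YoungDiagram.mem_iff_lt_colLen.2 hlam
        ext x
        exact fixesOutside_grassmannian lam k x (by omega)
      have hweight : ∀ T : SemistandardYoungTableau lam, weight k T = 0 := fun T => by
        rw [weight, hcells, Finset.sum_empty]
      rw [hone, schubertFamily_one, MvPolynomial.coeff_one]
      split_ifs with hγ
      · have : boundedTableaux lam k 0 γ = {SemistandardYoungTableau.highestWeight lam} := by
          ext T
          refine ⟨fun _ => ?_, fun _ => ⟨(hweight T).trans hγ, fun x hx => absurd hx (hmem x)⟩⟩
          refine Set.mem_singleton_iff.2 (SemistandardYoungTableau.ext fun i j => ?_)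
          rw [T.zeros (hmem _), SemistandardYoungTableau.zeros _ (hmem _)]
        rw [this, Set.ncard_singleton, Nat.cast_one]
      · have : boundedTableaux lam k 0 γ = ∅ :=
          Set.eq_empty_iff_forall_notMem.2 fun T hT => hγ ((hweight T).symm.trans hT.1)
        rw [this, Set.ncard_empty, Nat.cast_zero]
  | succ M ih =>
    obtain ⟨m, rfl⟩ : ∃ m, n = m + 1 := ⟨n - 1, by omega⟩
    have e : k + 1 - ((M + 1 : ℕ) : ℤ) = k - M := by push_cast; ring
    have e' : k - (M : ℤ) + 1 = k + 1 - M := by ring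
    rw [e, schubertFamily, e', coeff_fan_grassmannian (fun mu δ hmu => ih mu m δ hmu) _ lam γ
      (by omega), partialTableaux_eq_boundedTableaux k γ (by omega)]

theorem schur_eq_backStableSchubert (lam : YoungDiagram) (k : ℤ) :
    schur lam k = backStableSchubert (grassmannian lam k) := by
  ext γ
  obtain ⟨b, hb⟩ : ∃ b : ℤ, ∀ j ∈ γ.support, b ≤ j := by
    obtain ⟨b, hb⟩ := γ.support.finite_toSet.bddBelow
    exact ⟨b, fun j hj => hb hj⟩
  set M := (k + 1 - b).toNat
  have hγ : ∀ j < k + 1 - (M : ℤ), γ j = 0 := fun j hj => by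
    by_contra h
    have := hb j (Finsupp.mem_support_iff.2 h)
    omega
  rw [schur_apply, coeff_backStableSchubert (n := lam.rowLen 0 + M)
    (fixesOutside_grassmannian lam k) hγ (by push_cast; omega),
    coeff_schubertFamily_grassmannian k M lam _ γ le_rfl]
  congr 2
  ext T
  refine ⟨fun hT => ⟨hT, fun x hx => ?_⟩, fun hT => hT.1⟩
  have hT' : weight k T = γ := hT
  have h1 := weight_apply_ne_zero k T hx
  rw [hT'] at h1
  by_contra h2
  exact h1 (hγ _ (by omega))

theorem nablaValue_grassmannian (lam : YoungDiagram) (k : ℤ) :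
    nablaValue (grassmannian lam k)
      = ∑ c : {c : ℕ × ℕ // c ∈ removableBoxes lam},
          ((content c.1 + k : ℤ) : ℚ) • schur (removeBox lam c) k := by
  have hset : ∀ m : ℤ,
      length (simpleTransposition m * grassmannian lam k) + 1 = length (grassmannian lam k) ↔
        m ∈ Set.range fun c : {c : ℕ × ℕ // c ∈ removableBoxes lam} => k + content c.1 := by
    intro m
    rw [length_simpleTransposition_mul_add_one_iff (fixesOutside_grassmannian lam k).isFinitary,
      grassmannian_descent_iff]
    rfl
  have hinj : Function.Injective
      fun c : {c : ℕ × ℕ // c ∈ removableBoxes lam} => k + content c.1 :=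
    fun c d h => content_injective lam (add_left_cancel h)
  rw [nablaValue]
  simp only [hset]
  rw [finsum_mem_range hinj, finsum_eq_sum_of_fintype]
  refine Finset.sum_congr rfl fun c _ => ?_
  rw [simpleTransposition_mul_grassmannian, ← schur_eq_backStableSchubert, add_comm k]

/-! ### The operator `ξ` on Schur functions -/

/-- If `m` precedes all variables of `x^γ`, then the tableaux of weight `x^γ x_m` arise from
tableaux of weight `x^γ` by adding one box with the largest entry `k - m`. -/
theorem ncard_weight_add_single (lam : YoungDiagram) {k m : ℤ} {γ : ℤ →₀ ℕ} (hm : m ≤ k)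
    (hγ : ∀ j ∈ γ.support, m < j) :
    {T : SemistandardYoungTableau lam | weight k T = γ + Finsupp.single m 1}.ncard
      = ∑ c : {c : ℕ × ℕ // c ∈ removableBoxes lam},
          {T : SemistandardYoungTableau (removeBox lam c) | weight k T = γ}.ncard := by
  obtain ⟨n, rfl⟩ : ∃ n : ℕ, m = k - n := ⟨(k - m).toNat, by omega⟩
  have hγ0 : γ (k - n) = 0 := by
    by_contra h
    exact lt_irrefl _ (hγ _ (Finsupp.mem_support_iff.2 h))
  have hlt : ∀ {mu : YoungDiagram} {T : SemistandardYoungTableau mu}, weight k T = γ →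
      ∀ x ∈ mu, T x.1 x.2 < n := fun {mu T} hT x hx => by
    have h1 := weight_apply_ne_zero k T hx
    rw [hT] at h1
    have := hγ _ (Finsupp.mem_support_iff.2 h1)
    omega
  have hmem : ∀ (c : {c : ℕ × ℕ // c ∈ removableBoxes lam}) (x : ℕ × ℕ), x ≤ c.1 → x ≠ c.1 →
      x ∈ removeBox lam c := fun c x hx hne =>
    (mem_removeBox c).2 ⟨hne, lam.isLowerSet hx (removableBoxes_mem c)⟩
  have hrow : ∀ (c : {c : ℕ × ℕ // c ∈ removableBoxes lam})
      (T : {T : SemistandardYoungTableau (removeBox lam c) // weight k T = γ}),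
      ∀ j < c.1.2, T.1 c.1.1 j ≤ n := fun c T j hj =>
    (hlt T.2 (c.1.1, j) (hmem c _ ⟨le_rfl, hj.le⟩ fun h => hj.ne (congrArg Prod.snd h))).le
  have hcol : ∀ (c : {c : ℕ × ℕ // c ∈ removableBoxes lam})
      (T : {T : SemistandardYoungTableau (removeBox lam c) // weight k T = γ}),
      ∀ i < c.1.1, T.1 i c.1.2 < n := fun c T i hi =>
    hlt T.2 (i, c.1.2) (hmem c _ ⟨hi.le, le_rfl⟩ fun h => hi.ne (congrArg Prod.fst h))
  let f : (Σ c : {c : ℕ × ℕ // c ∈ removableBoxes lam},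
      {T : SemistandardYoungTableau (removeBox lam c) // weight k T = γ}) →
      {T : SemistandardYoungTableau lam // weight k T = γ + Finsupp.single (k - (n : ℤ)) 1} :=
    fun p => ⟨addEntry p.1 n p.2.1 (hrow p.1 p.2) (hcol p.1 p.2), by
      rw [weight_addEntry, p.2.2]⟩
  have hbij : Function.Bijective f := by
    constructor
    · rintro ⟨c, T⟩ ⟨d, S⟩ h
      have h' : ∀ i j, addEntry c n T.1 (hrow c T) (hcol c T) i j
          = addEntry d n S.1 (hrow d S) (hcol d S) i j := fun i j =>
        congrArg (fun U : {T : SemistandardYoungTableau lam //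
          weight k T = γ + Finsupp.single (k - (n : ℤ)) 1} => U.1 i j) h
      have hcd : c = d := by
        by_contra hne
        have hne' : c.1 ≠ d.1 := fun h => hne (Subtype.ext h)
        have h1 := h' c.1.1 c.1.2
        rw [addEntry_apply, addEntry_apply, if_pos rfl, if_neg hne'] at h1
        have := hlt S.2 c.1 ((mem_removeBox d).2 ⟨hne', removableBoxes_mem c⟩)
        omega
      subst hcd
      have hTS : T.1 = S.1 := by
        rw [← removeEntry_addEntry c n T.1 (hrow c T) (hcol c T),
          SemistandardYoungTableau.ext h', removeEntry_addEntry]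
      rw [Subtype.ext hTS]
    · rintro ⟨T, hT⟩
      have hcard : (lam.cells.filter fun c => k - (T c.1 c.2 : ℤ) = k - n).card = 1 := by
        rw [← weight_apply, hT, Finsupp.add_apply, hγ0, Finsupp.single_eq_same]
      obtain ⟨c, hc⟩ := Finset.card_eq_one.1 hcard
      have hc' : ∀ x ∈ lam, T x.1 x.2 = n ↔ x = c := fun x hx => by
        rw [← Finset.mem_singleton (a := c), ← hc, Finset.mem_filter, YoungDiagram.mem_cells]
        constructor
        · exact fun h => ⟨hx, by rw [h]⟩
        · rintro ⟨-, h⟩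
          omega
      have hclam : c ∈ lam := by
        have := Finset.mem_singleton_self c
        rw [← hc] at this
        exact (Finset.mem_filter.1 this).1
      have hcn : T c.1 c.2 = n := (hc' c hclam).2 rfl
      have hle : ∀ x ∈ lam, T x.1 x.2 ≤ n := fun x hx => by
        by_contra h
        have h1 := weight_apply_ne_zero k T hx
        rw [hT, Finsupp.add_apply, Finsupp.single_apply, if_neg (by omega), add_zero] at h1
        have := hγ _ (Finsupp.mem_support_iff.2 h1)
        omega
      have hrem : c ∈ removableBoxes lam := by
        refine mem_removableBoxes_iff.2 ⟨hclam, fun h => ?_, fun h => ?_⟩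
        · have h1 := T.col_strict (Nat.lt_add_one c.1) h
          have h2 := hle _ h
          dsimp only at h2
          omega
        · have h1 := T.row_weak (Nat.lt_add_one c.2) h
          have h2 := hle _ h
          have h3 := congrArg Prod.snd ((hc' _ h).1 (by dsimp only at h2 ⊢; omega))
          dsimp only at h3
          omega
      have hw : weight k (removeEntry ⟨c, hrem⟩ T) = γ := by
        have := weight_removeEntry k ⟨c, hrem⟩ T
        rw [hT, hcn] at this
        exact (add_right_cancel this).symm
      refine ⟨⟨⟨c, hrem⟩, ⟨removeEntry ⟨c, hrem⟩ T, hw⟩⟩, Subtype.ext ?_⟩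
      ext i j
      change (if (i, j) = c then n else removeEntry ⟨c, hrem⟩ T i j) = T i j
      rw [removeEntry_apply]
      split_ifs with h
      · have h' : (i, j) = c := h
        rw [← h'] at hcn
        exact hcn.symm
      · rfl
  have : ∀ c : {c : ℕ × ℕ // c ∈ removableBoxes lam},
      Finite {T : SemistandardYoungTableau (removeBox lam c) // weight k T = γ} := fun c =>
    (finite_weight_eq (removeBox lam c) k γ).to_subtype
  have := Nat.card_eq_of_bijective f hbij
  rw [Nat.card_sigma] at this
  exact this.symm

theorem eventually_coeff_schur (lam : YoungDiagram) (k : ℤ) (γ : ℤ →₀ ℕ) :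
    ∀ᶠ m : ℤ in atBot, MvPowerSeries.coeff (γ + Finsupp.single m 1) (schur lam k)
      = MvPowerSeries.coeff γ (∑ c : {c : ℕ × ℕ // c ∈ removableBoxes lam},
          schur (removeBox lam c) k) := by
  obtain ⟨b, hb⟩ : ∃ b : ℤ, ∀ j ∈ γ.support, b ≤ j := by
    obtain ⟨b, hb⟩ := γ.support.finite_toSet.bddBelow
    exact ⟨b, fun j hj => hb hj⟩
  filter_upwards [eventually_le_atBot k, eventually_lt_atBot b] with m h1 h2
  rw [schur_apply, ncard_weight_add_single lam h1 fun j hj => h2.trans_le (hb j hj), map_sum,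
    Nat.cast_sum]
  exact Finset.sum_congr rfl fun c _ => (schur_apply _ k γ).symm

end

end BackStable

theorem mainTheorem5 (lam : YoungDiagram) (k : ℤ) :
    (∃ h : BackStable.schur lam k ∈ BackStable.xi.domain,
      BackStable.xi ⟨BackStable.schur lam k, h⟩ =
        ∑ c : {c : ℕ × ℕ // c ∈ BackStable.removableBoxes lam},
          BackStable.schur (BackStable.removeBox lam c) k) ∧
    (∃ h : BackStable.schur lam k ∈ BackStable.nabla.domain,
      BackStable.nabla ⟨BackStable.schur lam k, h⟩ =
        ∑ c : {c : ℕ × ℕ // c ∈ BackStable.removableBoxes lam},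
          ((BackStable.content c.1 + k : ℤ) : ℚ) •
            BackStable.schur (BackStable.removeBox lam c) k) := by
  constructor
  · refine ⟨fun γ => ⟨_, BackStable.eventually_coeff_schur lam k γ⟩, ?_⟩
    funext γ
    exact BackStable.stableValue_eq (BackStable.eventually_coeff_schur lam k γ)
  · rw [← BackStable.nablaValue_grassmannian, BackStable.schur_eq_backStableSchubert]
    exact BackStable.nabla_backStableSchubert
      (BackStable.fixesOutside_grassmannian lam k).isFinitary
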